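/- **Setting.** Let $k\ge 1$ and let $\mathcal P=\{\mathcal P_{h,i}: h\ge 0,\ 0\le i<k^h\}$ be a $k$-ary hierarchical partition of a set $\mathcal X$: $\mathcal P_{0,0}=\mathcal X$, the cells of each depth are pairwise disjoint, and $\mathcal P_{h,i}=\bigcup_{j<k}\mathcal P_{h+1,ki+j}$. Every node $(h,i)$ has a representative point $x_{h,i}\in\mathcal P_{h,i}$; pulling a node means evaluating at $x_{h,i}$. There are $M\ge 1$ clients with local objectives $f_1,\dots,f_M:\mathcal X\to[0,1]$; put $\overline f=\frac1M\sum_m f_m$ and $f^*=\sup_{\mathcal X} f$ for any objective $f$. The rewards of all pulls are independent with values in $[0,1]$, and a pull of $(h,i)$ by client $m$ has mean $f_m(x_{h,i})$. Fix $\nu_1>0$ and $\rho\in(0,1)$. *Local smoothness (weak Lipschitz).* Each $f\in\{f_1,\dots,f_M,\overline f\}$ satisfies, for all nodes $(h,i)$ and all $x,y\in\mathcal P_{h,i}$, $f^*-f(y)\le (f^*-f(x))+\max\{f^*-f(x),\nu_1\rho^h\}$. *Heterogeneity level.* $\Delta$ is a number, given to the algorithm, with $|f_m^*-\overline f^*|\le\Delta$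 for all $m$. *Near-optimality dimension.* Fix $C\ge1$. For $\eta>0$ let $d_\eta(f)$ be the least $d\ge 0$ such that for every $h\ge0$ at most $C\rho^{-dh}$ nodes $(h,i)$ satisfy $\sup_{\mathcal P_{h,i}}f\ge f^*-\eta\nu_1\rho^h$. Put $\overline d=d_6(\overline f)$ and $d_{\max}=\max_m d_{12}(f_m)$. **Algorithm (PF-PNE).** Inputs: $\mathcal P$, $\nu_1$, $\rho$, $\Delta$, the horizon $T\ge1$, and constants $c\ge2$, $c_1\ge(2M^2)^{1/8}$, $\delta=1/M$. Let $\tau_h=\lceil c^2\log(c_1T/\delta)\rho^{-2h}/\nu_1^2\rceil$ and $n_h=\lceil\tau_h/M\rceil$. Call layer $h$ federated if $4\Delta\le\nu_1\rho^h$. Start with $\overline{\mathcal K}^0=\{(0,0)\}$, $\overline{\mathcal K}^0_m=\emptyset$. For $h=1,2,\dots$: 1. $\mathcal K^h$ is the set of children of $\overline{\mathcal K}^{h-1}$ if layer $h$ is federated, and $\emptyset$ otherwise; $\mathcal K_m^h$ is the set of children of $\overline{\mathcal K}^{h-1}\cup\overline{\mathcal K}_m^{h-1}$. 2. All clients together pull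 each node of $\mathcal K^h$ in turn, $n_h$ times each. Let $\overline\mu_{h,i}$ be the mean of the $Mn_h$ rewards of node $(h,i)$ and $b_h=c\sqrt{\log(c_1T/\delta)/(Mn_h)}$. With $i^p$ maximizing $\overline\mu_{h,\cdot}$ on $\mathcal K^h$, the server eliminates the nodes with $\overline\mu_{h,i}+b_h+\nu_1\rho^h<\overline\mu_{h,i^p}-b_h$; $\overline{\mathcal K}^h$ consists of the others. 3. Client $m$ then pulls each node of $\mathcal K_m^h\setminus\overline{\mathcal K}^h$ until it has pulled it $\tau_h$ times (first the nodes of $\mathcal K^h\setminus\overline{\mathcal K}^h$, then those of $\mathcal K^h_m\setminus\mathcal K^h$). On these nodes $\widehat\mu_{m,h,i}$ is the mean of its own $\tau_h$ rewards and $b_{m,h,i}=c\sqrt{\log(c_1T/\delta)/\tau_h}$; on $\overline{\mathcal K}^h$ it uses $\widehat\mu_{m,h,i}=\overline\mu_{h,i}$ and $b_{m,h,i}=b_h$. With $i_m^p$ maximizing $\widehat\mu_{m,h,\cdot}$ on $\mathcal K_m^h$, $\overline{\mathcal K}_m^h$ is the set of nodes of $\mathcal K_m^h\setminus\overline{\mathcal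 K}^h$ that do not satisfy $\widehat\mu_{m,h,i}+b_{m,h,i}+\nu_1\rho^h<\widehat\mu_{m,h,i_m^p}-b_{m,h,i_m^p}$. 4. In federated layers, a client that is done waits for the slowest client by pulling $(h,i_m^p)$. Nodes are processed in the order of their indices and ties are broken by the least index. Let $x_{m,t}$ be the point evaluated by client $m$ in round $t$, and $R(T)=\sum_{m=1}^M\sum_{t=1}^T\big(f_m^*-f_m(x_{m,t})\big)$ the cumulative personalized regret. **Theorem.** There are constants $K$ and $p$, depending only on $k,\nu_1,\rho,C,c$, such that in the setting above, for all $M,T\ge1$, $R(T)$ is integrable and $$\mathbb E[R(T)]\le K\,(1+\log c_1)\,(1+\log(MT))^p\left(M^{\frac{\overline d+1}{\overline d+2}}T^{\frac{\overline d+1}{\overline d+2}}+M\,T^{\frac{d_{\max}+1}{d_{\max}+2}}\right),$$ i.e. (for $c_1$ polynomial in $M$) $\mathbb E[R(T)]=\widetilde{\mathcal O}\Big(M^{\frac{\overline d+1}{\overline d+2}}T^{\frac{\overline d+1}{\overline d+2}}+M\,T^{\frac{d_{\max}+1}{d_{\max}+2}}\Big)$. -/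

import Mathlib

open MeasureTheory ProbabilityTheory

noncomputable section

/-- A `k`-ary hierarchical partition of `X`. The nodes of depth `h` are the pairs `(h, i)` with
`i < k ^ h`; the children of `(h, i)` are `(h + 1, k * i + j)` for `j < k`. Every node carries a
representative point, the point that is evaluated when the node is pulled. -/
structure HierarchicalPartition (X : Type*) (k : ℕ) where
  cell : ℕ → ℕ → Set X
  rep : ℕ → ℕ → X
  cell_root : cell 0 0 = Set.univ
  cell_split : ∀ h i, i < k ^ h → cell h i = ⋃ j ∈ Finset.range k, cell (h + 1) (k * i + j)
  cell_disjoint : ∀ h i j, i < k ^ h → j < k ^ h → i ≠ j → Disjoint (cell h i) (cell h j)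
  rep_mem : ∀ h i, i < k ^ h → rep h i ∈ cell h i

namespace XArmed

/-- The optimal value of an objective. -/
def optValue {X : Type*} (f : X → ℝ) : ℝ := ⨆ x, f x

/-- The averaged (global) objective. -/
def avgObjective {X : Type*} {M : ℕ} (f : Fin M → X → ℝ) : X → ℝ :=
  fun x => (∑ m, f m x) / M

/-- Local smoothness (weak Lipschitzness) along the partition: on a node of depth `h`,
`f* - f y ≤ (f* - f x) + max (f* - f x) (ν ρ ^ h)`. -/
def WeakLipschitz {X : Type*} {k : ℕ} (P : HierarchicalPartition X k) (ν ρ : ℝ)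
    (f : X → ℝ) : Prop :=
  ∀ h i, i < k ^ h → ∀ x ∈ P.cell h i, ∀ y ∈ P.cell h i,
    optValue f - f y ≤ (optValue f - f x) + max (optValue f - f x) (ν * ρ ^ h)

open scoped Classical in
/-- The number of `ε`-near-optimal nodes of depth `h`: those with `sup f ≥ f* - ε` on the node. -/
def nearOptCount {X : Type*} {k : ℕ} (P : HierarchicalPartition X k) (f : X → ℝ)
    (h : ℕ) (ε : ℝ) : ℕ :=
  ((Finset.range (k ^ h)).filter
    (fun i => optValue f - sSup (f '' P.cell h i) ≤ ε)).card

/-- The `(η, C)`-near-optimality dimension of `f`: the least `d ≥ 0` such that for every depth `h`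
at most `C ρ ^ (-d h)` nodes of depth `h` are `η ν ρ ^ h`-near-optimal. -/
def nearOptDim {X : Type*} {k : ℕ} (P : HierarchicalPartition X k) (ν ρ C η : ℝ)
    (f : X → ℝ) : ℝ :=
  sInf {d : ℝ | 0 ≤ d ∧
    ∀ h : ℕ, (nearOptCount P f h (η * (ν * ρ ^ h)) : ℝ) ≤ C * (ρ ^ h) ^ (-d)}

/-- Noisy bandit feedback. `Y m h i n` is the reward that client `m` observes at its `n`-th pull
(counted from `0`) of the node `(h, i)`: all rewards are independent, lie in `[0, 1]` almost
surely, and have the value of the local objective at the representative point as mean. -/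
structure IsRewardTable {X : Type*} {k M : ℕ} (P : HierarchicalPartition X k)
    (f : Fin M → X → ℝ) {Ω : Type*} [MeasurableSpace Ω] (μ : Measure Ω)
    (Y : Fin M → ℕ → ℕ → ℕ → Ω → ℝ) : Prop where
  measurable : ∀ m h i n, Measurable (Y m h i n)
  mem_Icc : ∀ m h i n, ∀ᵐ ω ∂μ, Y m h i n ω ∈ Set.Icc (0 : ℝ) 1
  mean : ∀ m h i n, i < k ^ h → ∫ ω, Y m h i n ω ∂μ = f m (P.rep h i)
  indep : iIndepFun (fun q : Fin M × ℕ × ℕ × ℕ => Y q.1 q.2.1 q.2.2.1 q.2.2.2) μ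

end XArmed

namespace PFPNE

/-- The inputs of the algorithm: arity `k`, number `M` of clients, horizon `T`, smoothness
parameters `ν, ρ`, confidence parameters `c, c₁, δ` and the heterogeneity level `Δ`. -/
structure Params where
  k : ℕ
  M : ℕ
  T : ℕ
  ν : ℝ
  ρ : ℝ
  c : ℝ
  c₁ : ℝ
  δ : ℝ
  Δ : ℝ

variable (a : Params)

/-- A realization of all rewards: `y m h i n` is the reward of the `n`-th pull of node `(h, i)`
by client `m`. -/
abbrev Rewards := Fin a.M → ℕ → ℕ → ℕ → ℝ

/-- `log (c₁ T / δ)`. -/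
def logTerm : ℝ := Real.log (a.c₁ * a.T / a.δ)

/-- The sampling threshold `τ_h = ⌈c² log (c₁ T / δ) ρ ^ (-2h) / ν²⌉` of depth `h`. -/
def tau (h : ℕ) : ℕ := ⌈a.c ^ 2 * logTerm a / (a.ν ^ 2 * a.ρ ^ (2 * h))⌉₊

/-- Number of pulls of a server node of depth `h` by each client: `⌈τ_h / M⌉`. -/
def share (h : ℕ) : ℕ := ⌈(tau a h : ℝ) / a.M⌉₊

/-- The federated learning process covers the depths `h ≤ H₀`, where `H₀` is the largest depth
with `4 Δ ≤ ν ρ ^ H₀`. After that the clients learn separately. -/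
def Federated (h : ℕ) : Prop := 4 * a.Δ ≤ a.ν * a.ρ ^ h

/-- The global estimate of node `(h, i)`: the mean of the `M ⌈τ_h / M⌉` rewards of all clients. -/
def globalMean (y : Rewards a) (h i : ℕ) : ℝ :=
  (∑ m, ∑ n ∈ Finset.range (share a h), y m h i n) / (a.M * share a h)

/-- The confidence width of the global estimates of depth `h`. -/
def globalWidth (h : ℕ) : ℝ := a.c * √(logTerm a / (a.M * share a h))

/-- The estimate of node `(h, i)` from the first `τ_h` rewards of client `m` alone. -/
def localMean (y : Rewards a) (m : Fin a.M) (h i : ℕ) : ℝ :=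
  (∑ n ∈ Finset.range (tau a h), y m h i n) / tau a h

/-- The confidence width of the local estimates of depth `h`. -/
def localWidth (h : ℕ) : ℝ := a.c * √(logTerm a / tau a h)

/-- The least maximizer of `g` on a finite nonempty set of indices. -/
def argmax (S : Finset ℕ) (g : ℕ → ℝ) : ℕ := sInf {i | i ∈ S ∧ ∀ j ∈ S, g j ≤ g i}

/-- The indices of all children of the nodes (of one depth) with index in `S`. -/
def children (S : Finset ℕ) : Finset ℕ :=
  S.biUnion fun i => (Finset.range a.k).image fun j => a.k * i + j

/-- The un-eliminated nodes after a layer: those of the server, and those that are kept by each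
client beyond the ones of the server. -/
structure State where
  server : Finset ℕ
  client : Fin a.M → Finset ℕ

variable {a}

open scoped Classical in
/-- The pre-eliminated nodes of the server on layer `h`. -/
def serverCand (s : State a) (h : ℕ) : Finset ℕ :=
  if Federated a h then children a s.server else ∅

/-- The pre-eliminated nodes of client `m` on layer `h` (those of the server included). -/
def clientCand (s : State a) (m : Fin a.M) : Finset ℕ :=
  children a (s.server ∪ s.client m)

open scoped Classical in
/-- The post-eliminated nodes of the server on layer `h`. -/
def serverKeep (y : Rewards a) (s : State a) (h : ℕ) : Finset ℕ :=
  (serverCand s h).filter fun i =>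
    ¬ (globalMean a y h i + globalWidth a h + a.ν * a.ρ ^ h <
      globalMean a y h (argmax (serverCand s h) (globalMean a y h)) - globalWidth a h)

open scoped Classical in
/-- The estimate that client `m` uses for node `(h, i)`: the (biased) global estimate on nodes kept
by the server, its own estimate on all others. -/
def clientMean (y : Rewards a) (s : State a) (m : Fin a.M) (h i : ℕ) : ℝ :=
  if i ∈ serverKeep y s h then globalMean a y h i else localMean a y m h i

open scoped Classical in
/-- The confidence width that a client uses for node `(h, i)`. -/
def clientWidth (y : Rewards a) (s : State a) (h i : ℕ) : ℝ :=
  if i ∈ serverKeep y s h then globalWidth a h else localWidth a h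

/-- The node of layer `h` that client `m` deems best. -/
def clientBest (y : Rewards a) (s : State a) (m : Fin a.M) (h : ℕ) : ℕ :=
  argmax (clientCand s m) (clientMean y s m h)

open scoped Classical in
/-- The post-eliminated nodes of client `m` on layer `h`, those kept by the server excluded. -/
def clientKeep (y : Rewards a) (s : State a) (m : Fin a.M) (h : ℕ) : Finset ℕ :=
  (clientCand s m \ serverKeep y s h).filter fun i =>
    ¬ (clientMean y s m h i + clientWidth y s h i + a.ν * a.ρ ^ h <
      clientMean y s m h (clientBest y s m h) - clientWidth y s h (clientBest y s m h))

/-- The state after the layers `1, …, h`. -/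
def state (y : Rewards a) : ℕ → State a
  | 0 => ⟨{0}, fun _ => ∅⟩
  | h + 1 => ⟨serverKeep y (state y h) (h + 1),
      fun m => clientKeep y (state y h) m (h + 1)⟩

/-- Pull the nodes of `S` one after the other, each of them `n` times. -/
def blocks (S : Finset ℕ) (n : ℕ) : List ℕ :=
  (S.sort (· ≤ ·)).flatMap fun i => List.replicate n i

/-- The pulls of layer `h` that all clients make together: the nodes of the server, `⌈τ_h / M⌉`
times each, then the nodes that the server has eliminated, up to `τ_h` times in total. -/
def sharedPulls (y : Rewards a) (s : State a) (h : ℕ) : List ℕ :=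
  blocks (serverCand s h) (share a h) ++
    blocks (serverCand s h \ serverKeep y s h) (tau a h - share a h)

/-- The pulls of layer `h` that client `m` makes on its own nodes, `τ_h` times each. -/
def ownPulls (s : State a) (m : Fin a.M) (h : ℕ) : List ℕ :=
  blocks (clientCand s m \ serverCand s h) (tau a h)

open scoped Classical in
/-- During the federated layers a client that is done with its own nodes waits for the slowest
client, so that all clients enter the next layer together. -/
def waitingTime (s : State a) (m : Fin a.M) (h : ℕ) : ℕ :=
  if Federated a h then
    (Finset.univ.sup fun m' : Fin a.M => (ownPulls s m' h).length) - (ownPulls s m h).length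
  else 0

/-- All pulls of client `m` on layer `h`. While waiting, it pulls the node that it deems best. -/
def layerPulls (y : Rewards a) (s : State a) (m : Fin a.M) (h : ℕ) : List ℕ :=
  sharedPulls y s h ++ ownPulls s m h ++
    List.replicate (waitingTime s m h) (clientBest y s m h)

/-- The nodes `(h, i)` pulled by client `m` on the layers `1, …, N`, in order. -/
def pulls (y : Rewards a) (m : Fin a.M) (N : ℕ) : List (ℕ × ℕ) :=
  (List.range N).flatMap fun h =>
    (layerPulls y (state y h) m (h + 1)).map fun i => (h + 1, i)

/-- The node pulled by client `m` in round `t` (counted from `0`). Every layer has at least one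
pull, so the first `t + 1` layers contain round `t`. -/
def nodeAt (y : Rewards a) (m : Fin a.M) (t : ℕ) : ℕ × ℕ :=
  (pulls y m (t + 1)).getD t (0, 0)

/-- The cumulative personalized regret `∑ₘ ∑ₜ (fₘ* - fₘ(x_{m,t}))` over `T` rounds. -/
def regret {X : Type*} (P : HierarchicalPartition X a.k) (f : Fin a.M → X → ℝ)
    (y : Rewards a) : ℝ :=
  ∑ m, ∑ t ∈ Finset.range a.T,
    (XArmed.optValue (f m) - f m (P.rep (nodeAt y m t).1 (nodeAt y m t).2))

end PFPNE

end

/-! The whole regret is bounded by a multiple of the second summand, `M * T ^ ((dmax + 1) / (dmax +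
2))`; the first summand is only used through its nonnegativity.

Deterministic part. Write v = ν ρ ^ h and assume that every estimate which matters within the
horizon is within 5/8 of its confidence width (`Good`). Then the cells in which the global or a
local objective approaches its supremum survive elimination (`exists_optNode_server`,
`exists_optNode_client`). The remaining 3/8 of the width pays for the bias, at most Δ ≤ v / 4, that
enters when a client compares a local estimate with a global one (`localWidth_slack`). Consequently
a node kept by the server has average gap at most 6 v over the clients, and a node that client m
keeps beyond these has gap at most 12 v for client m. By Markov's inequality at least half of the
clients have gap at most 12 v at a server node, so double counting bounds the server's nodes by 2 N
as well, where N = C ρ ^ (-dmax h) (`card_le_of_sum_gap_le`). Layer h + 1 therefore has at most 3 k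
N τ pulls, of order ρ ^ (-(dmax + 2) h) up to logarithms.

A server node is good only on average over the clients, so its cost has to be summed over all of
them. In federated layers the clients are synchronized: in each round there is one server node such
that every client pulls it or a node that is good for itself (`exists_common_node`). In the first
separate layer synchronization is lost. There the number of pulls of a server node has a bound that
is the same for all clients, because nodes are processed in index order, and the sums over clients
and nodes can be exchanged (`sum_handoverGap_le`). Every other round costs M times O(ρ ^ h) at most.
Splitting the layers at the scale T ^ (-1 / (dmax + 2)) then gives the rate (`sum_pow_layer_le`).

Probabilistic part. The candidates of layer h + 1 depend only on rewards of depth at most h, hence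
are independent of the rewards that estimate them. Hoeffding's inequality with a union bound over at
most T layers and at most T candidates each shows that `Good` fails with probability O(M T ^ 2 / (M
T) ^ 3). As the regret never exceeds M T, failure adds at most 4 to the expectation. -/

noncomputable section

namespace PFPNE

variable {a : Params}

/-- The standing assumptions on the inputs of the algorithm. -/
structure Params.Valid (a : Params) : Prop where
  k_pos : 0 < a.k
  M_pos : 0 < a.M
  T_pos : 0 < a.T
  ν_pos : 0 < a.ν
  ρ_pos : 0 < a.ρ
  ρ_lt_one : a.ρ < 1
  two_le_c : 2 ≤ a.c
  log_two_le : Real.log 2 / 8 ≤ logTerm a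

/-! ### Maximizers and children -/

lemma argmax_spec {S : Finset ℕ} (hS : S.Nonempty) (g : ℕ → ℝ) :
    argmax S g ∈ S ∧ ∀ j ∈ S, g j ≤ g (argmax S g) := by
  obtain ⟨i, hi, h⟩ := S.exists_max_image g hS
  exact Nat.sInf_mem (s := {i | i ∈ S ∧ ∀ j ∈ S, g j ≤ g i}) ⟨i, hi, h⟩

lemma argmax_le {S : Finset ℕ} {g : ℕ → ℝ} {i : ℕ} (hi : i ∈ S) (h : ∀ j ∈ S, g j ≤ g i) :
    argmax S g ≤ i :=
  Nat.sInf_le ⟨hi, h⟩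

/-- Each of the two maximizers competes in the other problem with the same value, so the two maxima
agree and the tie-breaking rule picks the same index. -/
lemma argmax_eq_argmax {S S' : Finset ℕ} {g g' : ℕ → ℝ} (hS : S.Nonempty) (hS' : S'.Nonempty)
    (h₁ : argmax S g ∈ S') (h₂ : argmax S' g' ∈ S) (e₁ : g (argmax S g) = g' (argmax S g))
    (e₂ : g (argmax S' g') = g' (argmax S' g')) : argmax S g = argmax S' g' := by
  have m₁ := (argmax_spec hS g).2
  have m₂ := (argmax_spec hS' g').2
  have e : g (argmax S g) = g (argmax S' g') :=
    le_antisymm (by rw [e₁, e₂]; exact m₂ _ h₁) (m₁ _ h₂)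
  refine le_antisymm (argmax_le h₂ fun j hj => e ▸ m₁ j hj) (argmax_le h₁ fun j hj => ?_)
  rw [← e₁, e, e₂]
  exact m₂ j hj

lemma mem_children {S : Finset ℕ} {i : ℕ} :
    i ∈ children a S ↔ ∃ p ∈ S, ∃ j < a.k, a.k * p + j = i := by
  simp [children]

lemma children_union (S S' : Finset ℕ) :
    children a (S ∪ S') = children a S ∪ children a S' := Finset.union_biUnion

lemma children_mono {S S' : Finset ℕ} (h : S ⊆ S') : children a S ⊆ children a S' :=
  Finset.biUnion_subset_biUnion_of_subset_left _ h

lemma children_nonempty (hk : 0 < a.k) {S : Finset ℕ} (h : S.Nonempty) :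
    (children a S).Nonempty := by
  obtain ⟨p, hp⟩ := h
  exact ⟨a.k * p + 0, mem_children.2 ⟨p, hp, 0, hk, rfl⟩⟩

lemma card_children_le (S : Finset ℕ) : (children a S).card ≤ a.k * S.card := by
  rw [mul_comm]
  refine Finset.card_biUnion_le_card_mul _ _ _ fun i _ => ?_
  exact Finset.card_image_le.trans (by simp)

lemma lt_of_mem_children {S : Finset ℕ} {h i : ℕ} (hS : ∀ p ∈ S, p < a.k ^ h)
    (hi : i ∈ children a S) : i < a.k ^ (h + 1) := by
  obtain ⟨p, hp, j, hj, rfl⟩ := mem_children.1 hi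
  have := hS p hp
  calc a.k * p + j < a.k * p + a.k := by omega
    _ = a.k * (p + 1) := by ring
    _ ≤ a.k * a.k ^ h := Nat.mul_le_mul_left _ this
    _ = a.k ^ (h + 1) := by ring

/-! ### Sample sizes and widths -/

lemma Params.Valid.logTerm_pos (H : a.Valid) : 0 < logTerm a :=
  lt_of_lt_of_le (by positivity) H.log_two_le

lemma Params.Valid.scale_pos (H : a.Valid) (h : ℕ) : 0 < a.ν * a.ρ ^ h :=
  mul_pos H.ν_pos (pow_pos H.ρ_pos h)

lemma Params.Valid.c_pos (H : a.Valid) : 0 < a.c := by linarith [H.two_le_c]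

lemma tau_pos (H : a.Valid) (h : ℕ) : 0 < tau a h := by
  have := H.logTerm_pos
  have := H.ν_pos
  have := H.ρ_pos
  have := H.c_pos
  exact Nat.ceil_pos.2 (by positivity)

lemma share_pos (H : a.Valid) (h : ℕ) : 0 < share a h := by
  have := tau_pos H h
  have := H.M_pos
  exact Nat.ceil_pos.2 (by positivity)

lemma share_le_tau (H : a.Valid) (h : ℕ) : share a h ≤ tau a h := by
  refine Nat.ceil_le.2 (div_le_self (by positivity) ?_)
  exact_mod_cast H.M_pos

lemma tau_le_M_mul_share (H : a.Valid) (h : ℕ) : (tau a h : ℝ) ≤ a.M * share a h := by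
  have hM : (0 : ℝ) < a.M := by exact_mod_cast H.M_pos
  have := Nat.le_ceil ((tau a h : ℝ) / a.M)
  rw [div_le_iff₀ hM] at this
  rw [mul_comm]
  exact this

lemma globalWidth_nonneg (H : a.Valid) (h : ℕ) : 0 ≤ globalWidth a h :=
  mul_nonneg H.c_pos.le (Real.sqrt_nonneg _)

lemma localWidth_nonneg (H : a.Valid) (h : ℕ) : 0 ≤ localWidth a h :=
  mul_nonneg H.c_pos.le (Real.sqrt_nonneg _)

lemma localWidth_le (H : a.Valid) (h : ℕ) : localWidth a h ≤ a.ν * a.ρ ^ h := by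
  have hL := H.logTerm_pos
  have hc := H.c_pos
  have hv := H.scale_pos h
  have ht : (0 : ℝ) < tau a h := by exact_mod_cast tau_pos H h
  have hle : a.c ^ 2 * logTerm a / (a.ν ^ 2 * a.ρ ^ (2 * h)) ≤ tau a h := Nat.le_ceil _
  have e : a.ν ^ 2 * a.ρ ^ (2 * h) = (a.ν * a.ρ ^ h) ^ 2 := by ring
  rw [e, div_le_iff₀ (by positivity)] at hle
  refine le_of_sq_le_sq ?_ hv.le
  rw [localWidth, mul_pow, Real.sq_sqrt (by positivity), ← mul_div_assoc, div_le_iff₀ ht]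
  linarith

lemma globalWidth_le_localWidth (H : a.Valid) (h : ℕ) : globalWidth a h ≤ localWidth a h := by
  have ht : (0 : ℝ) < tau a h := by exact_mod_cast tau_pos H h
  refine mul_le_mul_of_nonneg_left (Real.sqrt_le_sqrt ?_) H.c_pos.le
  exact div_le_div_of_nonneg_left H.logTerm_pos.le ht (tau_le_M_mul_share H h)

lemma globalWidth_le (H : a.Valid) (h : ℕ) : globalWidth a h ≤ a.ν * a.ρ ^ h :=
  (globalWidth_le_localWidth H h).trans (localWidth_le H h)

/-- The slack in the local width covers a quarter of the scale, unless scale and slack exceed `1`. -/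
lemma localWidth_slack (H : a.Valid) (h : ℕ) :
    a.ν * a.ρ ^ h / 4 ≤ 3 / 8 * localWidth a h ∨
      1 ≤ a.ν * a.ρ ^ h + 3 / 8 * localWidth a h := by
  have hL := H.logTerm_pos
  have hc := H.c_pos
  have hv := H.scale_pos h
  have hb := localWidth_nonneg H h
  have ht : (0 : ℝ) < tau a h := by exact_mod_cast tau_pos H h
  have e : a.ν ^ 2 * a.ρ ^ (2 * h) = (a.ν * a.ρ ^ h) ^ 2 := by ring
  have hsq : localWidth a h ^ 2 * tau a h = a.c ^ 2 * logTerm a := by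
    rw [localWidth, mul_pow, Real.sq_sqrt (by positivity)]
    field_simp
  -- With c ≥ 2 the product is at least 4 · log 2 / 8 ≈ 0.346.
  have hcl : (0.33 : ℝ) ≤ a.c ^ 2 * logTerm a := by
    have h2 := H.log_two_le
    have h3 := Real.log_two_gt_d9
    have h4 : (4 : ℝ) ≤ a.c ^ 2 := by nlinarith [H.two_le_c]
    nlinarith
  set v := a.ν * a.ρ ^ h
  set b := localWidth a h
  rcases le_total (1 : ℝ) (a.c ^ 2 * logTerm a / v ^ 2) with h1 | h1
  -- Rounding up a number that is at least 1 at most doubles it, so b ≥ v / √2, and 3 / (8 √2) > 1 /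
  -- 4.
  · left
    have hlt : (tau a h : ℝ) < a.c ^ 2 * logTerm a / v ^ 2 + 1 := by
      rw [tau, e]
      exact Nat.ceil_lt_add_one (by positivity)
    have h2 : (tau a h : ℝ) ≤ 2 * (a.c ^ 2 * logTerm a / v ^ 2) := by linarith
    have h3 : a.c ^ 2 * logTerm a ≤ b ^ 2 * (2 * (a.c ^ 2 * logTerm a / v ^ 2)) :=
      hsq.symm.trans_le (mul_le_mul_of_nonneg_left h2 (sq_nonneg b))
    have h4 : v ^ 2 ≤ 2 * b ^ 2 := by
      have hp : 0 < a.c ^ 2 * logTerm a := by positivity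
      have : b ^ 2 * (2 * (a.c ^ 2 * logTerm a / v ^ 2)) =
          (a.c ^ 2 * logTerm a) * (2 * b ^ 2 / v ^ 2) := by field_simp
      rw [this] at h3
      have h5 : 1 ≤ 2 * b ^ 2 / v ^ 2 := by
        by_contra hcon
        push Not at hcon
        nlinarith
      rwa [one_le_div (by positivity)] at h5
    nlinarith
  -- With a single sample b = c √L ≥ 0.57. If the first alternative fails, then v > 3 b / 2 and v +
  -- 3 b / 8 > 15 b / 8 > 1.
  · have h1' : tau a h = 1 := by
      have : tau a h ≤ 1 := by
        rw [tau, e]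
        exact Nat.ceil_le.2 (by simpa using h1)
      have := tau_pos H h
      omega
    rw [h1', Nat.cast_one, mul_one] at hsq
    have hb' : 0.57 ≤ b := by nlinarith
    by_cases hbv : v / 4 ≤ 3 / 8 * b
    · exact Or.inl hbv
    · right
      push Not at hbv
      linarith

/-! ### Elimination -/

lemma serverKeep_subset (y : Rewards a) (s : State a) (h : ℕ) :
    serverKeep y s h ⊆ serverCand s h := Finset.filter_subset _ _

lemma serverCand_subset_clientCand (s : State a) (m : Fin a.M) (h : ℕ) :
    serverCand s h ⊆ clientCand s m := by
  unfold serverCand clientCand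
  split_ifs
  · exact children_mono Finset.subset_union_left
  · exact Finset.empty_subset _

lemma clientCand_sdiff_subset (s : State a) (m : Fin a.M) {h : ℕ} (hf : Federated a h) :
    clientCand s m \ serverCand s h ⊆ children a (s.client m) := by
  intro i hi
  rw [clientCand, serverCand, if_pos hf, children_union, Finset.mem_sdiff, Finset.mem_union] at hi
  tauto

lemma serverKeep_nonempty (H : a.Valid) (y : Rewards a) (s : State a) {h : ℕ}
    (hs : (serverCand s h).Nonempty) : (serverKeep y s h).Nonempty := by
  refine ⟨argmax (serverCand s h) (globalMean a y h), Finset.mem_filter.2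
    ⟨(argmax_spec hs _).1, ?_⟩⟩
  linarith [globalWidth_nonneg H h, H.scale_pos h]

lemma clientBest_mem {s : State a} {m : Fin a.M} (hs : (clientCand s m).Nonempty) (y : Rewards a)
    (h : ℕ) : clientBest y s m h ∈ clientCand s m := (argmax_spec hs _).1

lemma clientWidth_nonneg (H : a.Valid) (y : Rewards a) (s : State a) (h i : ℕ) :
    0 ≤ clientWidth y s h i := by
  unfold clientWidth
  split_ifs
  exacts [globalWidth_nonneg H h, localWidth_nonneg H h]

lemma clientBest_mem_keep (H : a.Valid) {s : State a} {m : Fin a.M}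
    (hs : (clientCand s m).Nonempty) (y : Rewards a) (h : ℕ)
    (hb : clientBest y s m h ∉ serverKeep y s h) : clientBest y s m h ∈ clientKeep y s m h := by
  refine Finset.mem_filter.2 ⟨Finset.mem_sdiff.2 ⟨clientBest_mem hs y h, hb⟩, ?_⟩
  linarith [clientWidth_nonneg H y s h (clientBest y s m h), H.scale_pos h]

/-- All clients that deem a node of the server best agree on it. -/
lemma clientBest_eq {s : State a} {m m' : Fin a.M} (y : Rewards a) {h : ℕ}
    (hb : clientBest y s m h ∈ serverKeep y s h) (hb' : clientBest y s m' h ∈ serverKeep y s h) :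
    clientBest y s m h = clientBest y s m' h := by
  have hsub : ∀ m, serverKeep y s h ⊆ clientCand s m := fun m =>
    (serverKeep_subset y s h).trans (serverCand_subset_clientCand s m h)
  have e : ∀ i ∈ serverKeep y s h, clientMean y s m h i = clientMean y s m' h i := by
    intro i hi
    simp [clientMean, hi]
  exact argmax_eq_argmax ⟨_, hsub m hb⟩ ⟨_, hsub m' hb'⟩ (hsub m' hb) (hsub m hb') (e _ hb) (e _ hb')

lemma federated_anti (H : a.Valid) {h h' : ℕ} (hh : h ≤ h') (hf : Federated a h') :
    Federated a h := by
  unfold Federated at *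
  refine hf.trans (mul_le_mul_of_nonneg_left ?_ H.ν_pos.le)
  exact pow_le_pow_of_le_one H.ρ_pos.le H.ρ_lt_one.le hh

lemma server_nonempty (H : a.Valid) (y : Rewards a) (h : ℕ) (hf : h = 0 ∨ Federated a h) :
    (state y h).server.Nonempty := by
  induction h with
  | zero => exact ⟨0, by simp [state]⟩
  | succ h ih =>
    have hf' : Federated a (h + 1) := by simpa using hf
    refine serverKeep_nonempty H y _ ?_
    rw [serverCand, if_pos hf']
    exact children_nonempty H.k_pos (ih (Or.inr (federated_anti H (by omega) hf')))

lemma server_eq_empty (y : Rewards a) {h : ℕ} (hf : ¬ Federated a (h + 1)) :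
    (state y (h + 1)).server = ∅ := by
  simp [state, serverKeep, serverCand, hf]

lemma eq_zero_or_federated_of_mem_server {y : Rewards a} {h i : ℕ}
    (hi : i ∈ (state y h).server) : h = 0 ∨ Federated a h := by
  rcases h with _ | h
  · exact Or.inl rfl
  · by_contra hcon
    rw [server_eq_empty y (by simpa using hcon)] at hi
    simp at hi

/-- The node that a client deems best passes its own test, so it stays with the server or with the
client. This is why every layer contains a pull. -/
lemma union_nonempty (H : a.Valid) (y : Rewards a) (m : Fin a.M) (h : ℕ) :
    ((state y h).server ∪ (state y h).client m).Nonempty := by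
  induction h with
  | zero => exact ⟨0, by simp [state]⟩
  | succ h ih =>
    have hs : (clientCand (state y h) m).Nonempty := children_nonempty H.k_pos ih
    refine ⟨clientBest y (state y h) m (h + 1), Finset.mem_union.2 ?_⟩
    by_cases hb : clientBest y (state y h) m (h + 1) ∈ serverKeep y (state y h) (h + 1)
    · exact Or.inl hb
    · exact Or.inr (clientBest_mem_keep H hs y _ hb)

lemma clientCand_nonempty (H : a.Valid) (y : Rewards a) (m : Fin a.M) (h : ℕ) :
    (clientCand (state y h) m).Nonempty :=
  children_nonempty H.k_pos (union_nonempty H y m h)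

lemma lt_of_mem_state (y : Rewards a) (h : ℕ) :
    (∀ i ∈ (state y h).server, i < a.k ^ h) ∧
      ∀ m, ∀ i ∈ (state y h).client m, i < a.k ^ h := by
  induction h with
  | zero => simp [state]
  | succ h ih =>
    have hc : ∀ m, ∀ i ∈ clientCand (state y h) m, i < a.k ^ (h + 1) := by
      intro m i hi
      refine lt_of_mem_children (fun p hp => ?_) hi
      rcases Finset.mem_union.1 hp with hp | hp
      exacts [ih.1 p hp, ih.2 m p hp]
    refine ⟨fun i hi => ?_, fun m i hi => ?_⟩
    · have := serverKeep_subset y _ _ hi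
      rw [serverCand] at this
      split_ifs at this
      · exact lt_of_mem_children ih.1 this
      · simp at this
    · exact hc m i (Finset.mem_sdiff.1 (Finset.mem_filter.1 hi).1).1

lemma lt_of_mem_clientCand {y : Rewards a} {m : Fin a.M} {h i : ℕ}
    (hi : i ∈ clientCand (state y h) m) : i < a.k ^ (h + 1) := by
  refine lt_of_mem_children (fun p hp => ?_) hi
  rcases Finset.mem_union.1 hp with hp | hp
  exacts [(lt_of_mem_state y h).1 p hp, (lt_of_mem_state y h).2 m p hp]

/-! ### Lists of pulls -/

lemma length_blocks (S : Finset ℕ) (n : ℕ) : (blocks S n).length = S.card * n := by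
  simp [blocks, List.length_flatMap]

lemma mem_of_mem_blocks {S : Finset ℕ} {n i : ℕ} (h : i ∈ blocks S n) : i ∈ S := by
  simp only [blocks, List.mem_flatMap, Finset.mem_sort] at h
  obtain ⟨j, hj, hi⟩ := h
  rwa [List.eq_of_mem_replicate hi]

lemma mem_clientCand_of_mem_layerPulls {y : Rewards a} {s : State a} {m : Fin a.M} {h i : ℕ}
    (hs : (clientCand s m).Nonempty) (hi : i ∈ layerPulls y s m h) : i ∈ clientCand s m := by
  simp only [layerPulls, sharedPulls, ownPulls, List.mem_append] at hi
  rcases hi with ((hi | hi) | hi) | hi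
  · exact serverCand_subset_clientCand s m h (mem_of_mem_blocks hi)
  · exact serverCand_subset_clientCand s m h (Finset.mem_sdiff.1 (mem_of_mem_blocks hi)).1
  · exact (Finset.mem_sdiff.1 (mem_of_mem_blocks hi)).1
  · rw [List.eq_of_mem_replicate hi]
    exact clientBest_mem hs y h

lemma length_sharedPulls_le (H : a.Valid) (y : Rewards a) (s : State a) (h : ℕ) :
    (sharedPulls y s h).length ≤ (serverCand s h).card * tau a h := by
  simp only [sharedPulls, List.length_append, length_blocks]
  have h1 := Finset.card_le_card (Finset.sdiff_subset (s := serverCand s h) (t := serverKeep y s h))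
  obtain ⟨d, hd⟩ := Nat.exists_eq_add_of_le (share_le_tau H h)
  rw [hd, Nat.add_sub_cancel_left, mul_add]
  gcongr

lemma card_clientCand_le (H : a.Valid) (y : Rewards a) (s : State a) (m : Fin a.M) (h : ℕ) :
    (clientCand s m).card ≤ (sharedPulls y s h ++ ownPulls s m h).length := by
  simp only [sharedPulls, ownPulls, List.length_append, length_blocks]
  have h1 := Finset.card_sdiff_add_card_eq_card (serverCand_subset_clientCand s m h)
  have h2 := Nat.le_mul_of_pos_right (serverCand s h).card (share_pos H h)
  have h3 := Nat.le_mul_of_pos_right (clientCand s m \ serverCand s h).card (tau_pos H h)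
  omega

lemma card_clientCand_le_length (H : a.Valid) (y : Rewards a) (s : State a) (m : Fin a.M) (h : ℕ) :
    (clientCand s m).card ≤ (layerPulls y s m h).length := by
  refine (card_clientCand_le H y s m h).trans ?_
  rw [layerPulls, List.length_append (bs := List.replicate _ _)]
  omega

/-- Waiting pads the own pulls to those of the slowest client; the resulting length does not depend
on the client, which keeps the clients synchronized. -/
lemma length_layerPulls_of_federated (y : Rewards a) (s : State a) (m : Fin a.M) {h : ℕ}
    (hf : Federated a h) : (layerPulls y s m h).length =
      (sharedPulls y s h).length +
        Finset.univ.sup fun m' : Fin a.M => (ownPulls s m' h).length := by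
  have : (ownPulls s m h).length ≤ Finset.univ.sup fun m' : Fin a.M => (ownPulls s m' h).length :=
    Finset.le_sup (f := fun m' : Fin a.M => (ownPulls s m' h).length) (Finset.mem_univ m)
  simp only [layerPulls, waitingTime, if_pos hf, List.length_append, List.length_replicate]
  omega

lemma layerPulls_of_not_federated (y : Rewards a) (s : State a) (m : Fin a.M) {h : ℕ}
    (hf : ¬ Federated a h) : layerPulls y s m h = blocks (clientCand s m) (tau a h) := by
  simp [layerPulls, waitingTime, hf, sharedPulls, serverCand, ownPulls, blocks]

/-- The round in which client `m` enters layer `h + 1`. -/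
def start (y : Rewards a) (m : Fin a.M) (h : ℕ) : ℕ :=
  ∑ j ∈ Finset.range h, (layerPulls y (state y j) m (j + 1)).length

lemma start_succ (y : Rewards a) (m : Fin a.M) (h : ℕ) :
    start y m (h + 1) = start y m h + (layerPulls y (state y h) m (h + 1)).length :=
  Finset.sum_range_succ _ _

lemma length_layerPulls_pos (H : a.Valid) (y : Rewards a) (m : Fin a.M) (h : ℕ) :
    0 < (layerPulls y (state y h) m (h + 1)).length :=
  lt_of_lt_of_le (Finset.card_pos.2 (clientCand_nonempty H y m h))
    (card_clientCand_le_length H y _ m _)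

lemma start_strictMono (H : a.Valid) (y : Rewards a) (m : Fin a.M) : StrictMono (start y m) := by
  refine strictMono_nat_of_lt_succ fun h => ?_
  rw [start_succ]
  have := length_layerPulls_pos H y m h
  omega

lemma exists_start_le (H : a.Valid) (y : Rewards a) (m : Fin a.M) (t : ℕ) :
    ∃ h, start y m h ≤ t ∧ t < start y m (h + 1) := by
  have hex : ∃ h, t < start y m (h + 1) :=
    ⟨t, lt_of_lt_of_le (Nat.lt_succ_self t) ((start_strictMono H y m).le_apply)⟩
  classical
  refine ⟨Nat.find hex, ?_, Nat.find_spec hex⟩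
  rcases hh : Nat.find hex with _ | h
  · simp [start]
  · exact not_lt.1 (Nat.find_min hex (m := h) (by omega))

/-- The number of layers that client `m` has completed before round `t`. -/
def layerIdx (y : Rewards a) (m : Fin a.M) (t : ℕ) : ℕ := sInf {h | t < start y m (h + 1)}

lemma layerIdx_spec (H : a.Valid) (y : Rewards a) (m : Fin a.M) (t : ℕ) :
    start y m (layerIdx y m t) ≤ t ∧ t < start y m (layerIdx y m t + 1) := by
  obtain ⟨h, h1, h2⟩ := exists_start_le H y m t
  have hm : t < start y m (layerIdx y m t + 1) := Nat.sInf_mem (s := {h | t < start y m (h + 1)})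
    ⟨h, h2⟩
  have hle : layerIdx y m t ≤ h := Nat.sInf_le (s := {h | t < start y m (h + 1)}) h2
  exact ⟨((start_strictMono H y m).monotone hle).trans h1, hm⟩

lemma layerIdx_eq (H : a.Valid) {y : Rewards a} {m : Fin a.M} {t h : ℕ} (h1 : start y m h ≤ t)
    (h2 : t < start y m (h + 1)) : layerIdx y m t = h := by
  obtain ⟨h3, h4⟩ := layerIdx_spec H y m t
  have hm := start_strictMono H y m
  have := hm.lt_iff_lt.1 (h1.trans_lt h4)
  have := hm.lt_iff_lt.1 (h3.trans_lt h2)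
  omega

lemma layerIdx_le (H : a.Valid) (y : Rewards a) (m : Fin a.M) (t : ℕ) : layerIdx y m t ≤ t :=
  (start_strictMono H y m).le_apply.trans (layerIdx_spec H y m t).1

lemma pulls_succ (y : Rewards a) (m : Fin a.M) (N : ℕ) : pulls y m (N + 1) = pulls y m N ++
    (layerPulls y (state y N) m (N + 1)).map fun i => (N + 1, i) := by
  simp [pulls, List.range_succ]

lemma length_pulls (y : Rewards a) (m : Fin a.M) (N : ℕ) : (pulls y m N).length = start y m N := by
  induction N with
  | zero => simp [pulls, start]
  | succ N ih => rw [pulls_succ, start_succ, List.length_append, ih, List.length_map]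

lemma pulls_getD (y : Rewards a) (m : Fin a.M) {h N t : ℕ} (hN : h < N) (h1 : start y m h ≤ t)
    (h2 : t < start y m (h + 1)) : (pulls y m N).getD t (0, 0) =
      (h + 1, (layerPulls y (state y h) m (h + 1)).getD (t - start y m h) 0) := by
  induction N, hN using Nat.le_induction with
  | base =>
    have hlt : t - start y m h < (layerPulls y (state y h) m (h + 1)).length := by
      rw [start_succ] at h2
      omega
    rw [pulls_succ, List.getD_append_right _ _ _ _ (by rw [length_pulls]; exact h1), length_pulls,
      List.getD_eq_getElem _ _ (by simpa using hlt), List.getD_eq_getElem _ _ hlt]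
    simp
  | succ N hN ih =>
    have hlt : t < (pulls y m N).length := by
      rw [length_pulls]
      refine h2.trans_le ?_
      exact Finset.sum_le_sum_of_subset (Finset.range_subset_range.2 hN)
    rw [pulls_succ, List.getD_append _ _ _ _ hlt, ih]

/-- The node index of the pull in round `t`. -/
lemma nodeAt_eq (H : a.Valid) (y : Rewards a) (m : Fin a.M) (t : ℕ) :
    nodeAt y m t = (layerIdx y m t + 1, (layerPulls y (state y (layerIdx y m t)) m
      (layerIdx y m t + 1)).getD (t - start y m (layerIdx y m t)) 0) := by
  obtain ⟨h1, h2⟩ := layerIdx_spec H y m t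
  exact pulls_getD y m (Nat.lt_succ_of_le (layerIdx_le H y m t)) h1 h2

lemma start_eq_of_federated (H : a.Valid) (y : Rewards a) (m m' : Fin a.M) {h : ℕ}
    (hf : h = 0 ∨ Federated a h) : start y m h = start y m' h := by
  refine Finset.sum_congr rfl fun j hj => ?_
  have hj := Finset.mem_range.1 hj
  have : Federated a (j + 1) := federated_anti H (by omega) (hf.resolve_left (by omega))
  rw [length_layerPulls_of_federated _ _ _ this, length_layerPulls_of_federated _ _ _ this]

/-- Both ends of a federated layer are common to all clients, so a single client inside it forces
all the others to be there. -/
lemma layerIdx_eq_of_federated (H : a.Valid) {y : Rewards a} {m : Fin a.M} {t : ℕ}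
    (hf : Federated a (layerIdx y m t + 1)) (m' : Fin a.M) : layerIdx y m' t = layerIdx y m t := by
  obtain ⟨h1, h2⟩ := layerIdx_spec H y m t
  refine layerIdx_eq H ?_ ?_
  · rwa [start_eq_of_federated H y m' m (Or.inr (federated_anti H (Nat.le_succ _) hf))]
  · rwa [start_eq_of_federated H y m' m (Or.inr hf)]

end PFPNE

/-! ### Optimal nodes, weak Lipschitzness and counting of near-optimal nodes -/

namespace XArmed

variable {X : Type*} {k : ℕ} {P : HierarchicalPartition X k} {ν ρ : ℝ} {f : X → ℝ}

lemma le_optValue (hf : ∀ x, f x ∈ Set.Icc (0 : ℝ) 1) (x : X) : f x ≤ optValue f :=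
  le_ciSup (f := f) ⟨1, by rintro _ ⟨x, rfl⟩; exact (hf x).2⟩ x

lemma optValue_le_one (P : HierarchicalPartition X k) (hf : ∀ x, f x ∈ Set.Icc (0 : ℝ) 1) :
    optValue f ≤ 1 :=
  have : Nonempty X := ⟨P.rep 0 0⟩
  ciSup_le fun x => (hf x).2

lemma avgObjective_mem_Icc {M : ℕ} (hM : 0 < M) {f : Fin M → X → ℝ}
    (hf : ∀ m x, f m x ∈ Set.Icc (0 : ℝ) 1) (x : X) : avgObjective f x ∈ Set.Icc (0 : ℝ) 1 := by
  have hM' : (0 : ℝ) < M := by exact_mod_cast hM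
  refine ⟨div_nonneg (Finset.sum_nonneg fun m _ => (hf m x).1) hM'.le, ?_⟩
  rw [avgObjective, div_le_one hM']
  calc ∑ m, f m x ≤ ∑ _m : Fin M, (1 : ℝ) := Finset.sum_le_sum fun m _ => (hf m x).2
    _ = M := by simp

/-- A node is optimal if the supremum of the objective is approached on its cell. -/
def OptNode (P : HierarchicalPartition X k) (f : X → ℝ) (h i : ℕ) : Prop :=
  ∀ ε > 0, ∃ x ∈ P.cell h i, optValue f - ε < f x

lemma optNode_root (P : HierarchicalPartition X k) (f : X → ℝ) : OptNode P f 0 0 := by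
  intro ε hε
  have : Nonempty X := ⟨P.rep 0 0⟩
  obtain ⟨x, hx⟩ := exists_lt_of_lt_ciSup (f := f) (sub_lt_self (optValue f) hε)
  exact ⟨x, by rw [P.cell_root]; trivial, hx⟩

/-- The supremum need not be attained, so no point can be followed down the tree. Instead, if every
child stayed below the optimum by a margin, the least of these finitely many margins would work for
the parent. -/
lemma OptNode.exists_child {h i : ℕ} (ho : OptNode P f h i) (hi : i < k ^ h) :
    ∃ j < k, OptNode P f (h + 1) (k * i + j) := by
  by_contra hcon
  push Not at hcon
  have : ∀ j : ℕ, ∃ ε > 0, j < k → ∀ x ∈ P.cell (h + 1) (k * i + j), f x ≤ optValue f - ε := by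
    intro j
    by_cases hj : j < k
    · have := hcon j hj
      simp only [OptNode] at this
      push Not at this
      obtain ⟨ε, hε, h2⟩ := this
      exact ⟨ε, hε, fun _ => h2⟩
    · exact ⟨1, one_pos, fun h => absurd h hj⟩
  choose ε hε hle using this
  obtain ⟨δ, hδ, hδle⟩ : ∃ δ > 0, ∀ j < k, δ ≤ ε j := by
    rcases Nat.eq_zero_or_pos k with rfl | hk
    · exact ⟨1, one_pos, by simp⟩
    · obtain ⟨j, -, hj⟩ := (Finset.range k).exists_min_image ε ⟨0, by simpa using hk⟩
      exact ⟨ε j, hε j, fun l hl => hj l (by simpa using hl)⟩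
  obtain ⟨x, hx, hfx⟩ := ho δ hδ
  rw [P.cell_split h i hi] at hx
  simp only [Finset.mem_range, Set.mem_iUnion, exists_prop] at hx
  obtain ⟨j, hj, hx⟩ := hx
  linarith [hle j hj x hx, hδle j hj]

lemma WeakLipschitz.gap_le_of_optNode (hw : WeakLipschitz P ν ρ f) (hν : 0 < ν) (hρ : 0 < ρ)
    {h i : ℕ} (hi : i < k ^ h) (ho : OptNode P f h i) {x : X} (hx : x ∈ P.cell h i) :
    optValue f - f x ≤ ν * ρ ^ h := by
  have hv : 0 < ν * ρ ^ h := by positivity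
  refine le_of_forall_pos_le_add fun ε hε => ?_
  -- A gap of z below the scale makes the maximum in the smoothness condition equal to the scale; a
  -- gap below ε is the error allowed.
  obtain ⟨z, hz, hfz⟩ := ho (min ε (ν * ρ ^ h)) (lt_min hε hv)
  have h1 := hw h i hi z hz x hx
  have h2 := min_le_left ε (ν * ρ ^ h)
  have h3 := min_le_right ε (ν * ρ ^ h)
  rw [max_eq_right (by linarith)] at h1
  linarith

/-- Used to pass from the representative of a kept node to those of its children, at the price of a
factor 2. -/
lemma WeakLipschitz.gap_le (hw : WeakLipschitz P ν ρ f) {h i : ℕ} (hi : i < k ^ h) {b : ℝ}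
    (hb : ν * ρ ^ h ≤ b) {x y : X} (hx : x ∈ P.cell h i) (hy : y ∈ P.cell h i)
    (hg : optValue f - f x ≤ b) : optValue f - f y ≤ 2 * b := by
  have := hw h i hi x hx y hy
  linarith [max_le hg hb]

lemma WeakLipschitz.gap_le_root (hw : WeakLipschitz P ν ρ f) (hν : 0 < ν) (hρ : 0 < ρ) (x : X) :
    optValue f - f x ≤ ν := by
  simpa using hw.gap_le_of_optNode hν hρ (h := 0) (i := 0) (by simp) (optNode_root P f)
    (x := x) (by rw [P.cell_root]; trivial)

lemma rep_child_mem {h p j : ℕ} (P : HierarchicalPartition X k) (hp : p < k ^ h) (hj : j < k) :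
    P.rep (h + 1) (k * p + j) ∈ P.cell h p := by
  rw [P.cell_split h p hp]
  simp only [Finset.mem_range, Set.mem_iUnion, exists_prop]
  refine ⟨j, hj, P.rep_mem _ _ ?_⟩
  calc k * p + j < k * (p + 1) := by linarith
    _ ≤ k * k ^ h := Nat.mul_le_mul_left _ hp
    _ = k ^ (h + 1) := by ring

lemma card_le_nearOptCount (hf : ∀ x, f x ∈ Set.Icc (0 : ℝ) 1) {h : ℕ} {ε : ℝ} {S : Finset ℕ}
    (hS : ∀ i ∈ S, i < k ^ h ∧ optValue f - f (P.rep h i) ≤ ε) :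
    S.card ≤ nearOptCount P f h ε := by
  classical
  unfold nearOptCount
  refine Finset.card_le_card fun i hi => ?_
  obtain ⟨h1, h2⟩ := hS i hi
  simp only [Finset.mem_filter, Finset.mem_range]
  refine ⟨h1, ?_⟩
  have : f (P.rep h i) ≤ sSup (f '' P.cell h i) :=
    le_csSup ⟨1, by rintro _ ⟨x, -, rfl⟩; exact (hf x).2⟩ ⟨_, P.rep_mem h i h1, rfl⟩
  linarith

lemma nearOptDim_nonneg (P : HierarchicalPartition X k) (ν ρ C η : ℝ) (f : X → ℝ) :
    0 ≤ nearOptDim P ν ρ C η f := Real.sInf_nonneg fun _ hd => hd.1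

/-- The infimum that defines the dimension is attained: for fixed depth the condition on d is
closed, by continuity in the exponent. Enlarging d only weakens the bound, since ρ ^ h ≤ 1. -/
lemma nearOptCount_le (hk : 0 < k) (hρ : 0 < ρ) (hρ1 : ρ < 1) {C η D : ℝ} (hC : 1 ≤ C)
    (hD : nearOptDim P ν ρ C η f ≤ D) (h : ℕ) :
    (nearOptCount P f h (η * (ν * ρ ^ h)) : ℝ) ≤ C * (ρ ^ h) ^ (-D) := by
  set A := {d : ℝ | 0 ≤ d ∧
    ∀ h : ℕ, (nearOptCount P f h (η * (ν * ρ ^ h)) : ℝ) ≤ C * (ρ ^ h) ^ (-d)} with hA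
  have hk1 : (1 : ℝ) ≤ k := by exact_mod_cast hk
  have hlog : Real.log ρ < 0 := Real.log_neg hρ hρ1
  have hne : A.Nonempty := by
    -- For this exponent ρ ^ (-d h) = k ^ h, the total number of nodes of depth h.
    refine ⟨Real.log k / -Real.log ρ, div_nonneg (Real.log_nonneg hk1) (by linarith), fun h => ?_⟩
    have e : (ρ ^ h) ^ (-(Real.log k / -Real.log ρ)) = (k : ℝ) ^ h := by
      rw [Real.rpow_def_of_pos (by positivity), Real.log_pow, ← Real.exp_log (by positivity :
        (0 : ℝ) < (k : ℝ) ^ h), Real.log_pow]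
      congr 1
      field_simp [hlog.ne]
    rw [e]
    have h1 : nearOptCount P f h (η * (ν * ρ ^ h)) ≤ k ^ h := by
      classical
      unfold nearOptCount
      exact (Finset.card_filter_le _ _).trans (by simp)
    have h2 : (nearOptCount P f h (η * (ν * ρ ^ h)) : ℝ) ≤ (k : ℝ) ^ h := by exact_mod_cast h1
    nlinarith [pow_pos (by linarith : (0 : ℝ) < k) h]
  have hpos : 0 < ρ ^ h := by positivity
  have hcl : IsClosed {d : ℝ | (nearOptCount P f h (η * (ν * ρ ^ h)) : ℝ) ≤
      C * (ρ ^ h) ^ (-d)} := by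
    refine isClosed_le continuous_const (continuous_const.mul ?_)
    exact (Real.continuous_const_rpow hpos.ne').comp continuous_neg
  have hmem : sInf A ∈ {d : ℝ | (nearOptCount P f h (η * (ν * ρ ^ h)) : ℝ) ≤
      C * (ρ ^ h) ^ (-d)} :=
    closure_minimal (fun d hd => hd.2 h) hcl (csInf_mem_closure hne ⟨0, fun d hd => hd.1⟩)
  refine le_trans (by exact hmem) (mul_le_mul_of_nonneg_left ?_ (by linarith))
  refine Real.rpow_le_rpow_of_exponent_ge hpos (pow_le_one₀ hρ.le hρ1.le) ?_
  exact neg_le_neg hD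

/-- If each node of `S` is near-optimal on average over the objectives, then at least half of the
objectives are near-optimal at it, so `S` has at most twice as many elements as there are
near-optimal nodes per objective. -/
lemma card_le_of_sum_gap_le {M : ℕ} (hM : 0 < M) {f : Fin M → X → ℝ}
    (hf : ∀ m x, f m x ∈ Set.Icc (0 : ℝ) 1) {h : ℕ} {v N : ℝ} (hv : 0 < v)
    (hN : ∀ m, (nearOptCount P (f m) h (12 * v) : ℝ) ≤ N) {S : Finset ℕ}
    (hS : ∀ i ∈ S, i < k ^ h ∧ ∑ m, (optValue (f m) - f m (P.rep h i)) ≤ M * (6 * v)) :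
    (S.card : ℝ) ≤ 2 * N := by
  classical
  have hM' : (0 : ℝ) < M := by exact_mod_cast hM
  let g : Fin M → ℕ → ℝ := fun m i => optValue (f m) - f m (P.rep h i)
  have hg : ∀ m i, 0 ≤ g m i := fun m i => sub_nonneg.2 (le_optValue (hf m) _)
  have hhalf : ∀ i ∈ S, (M : ℝ) / 2 ≤ ∑ m, if g m i ≤ 12 * v then (1 : ℝ) else 0 := by
    intro i hi
    -- Markov's inequality: each client with a gap above 12 v contributes at least 12 v to a sum of
    -- at most 6 M v.
    have h1 : ∑ m : Fin M, (12 * v) * (1 - if g m i ≤ 12 * v then (1 : ℝ) else 0) ≤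
        M * (6 * v) := by
      refine (Finset.sum_le_sum fun m _ => ?_).trans (hS i hi).2
      change _ ≤ g m i
      split_ifs with hc
      · simpa using hg m i
      · push Not at hc
        simpa using hc.le
    rw [← Finset.mul_sum, Finset.sum_sub_distrib] at h1
    simp only [Finset.sum_const, Finset.card_univ, Fintype.card_fin, nsmul_eq_mul, mul_one] at h1
    have h2 : v * (M - ∑ m, if g m i ≤ 12 * v then (1 : ℝ) else 0) ≤ v * (M / 2) := by linarith
    linarith [le_of_mul_le_mul_left h2 hv]
  -- Pairs of a client and a node that is near-optimal for it are counted once by nodes and once by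
  -- clients.
  have h1 : (S.card : ℝ) * (M / 2) ≤ ∑ m : Fin M, ∑ i ∈ S, if g m i ≤ 12 * v then (1 : ℝ) else 0 := by
    rw [Finset.sum_comm, ← nsmul_eq_mul]
    exact Finset.card_nsmul_le_sum _ _ _ hhalf
  have h2 : ∑ m : Fin M, (∑ i ∈ S, if g m i ≤ 12 * v then (1 : ℝ) else 0) ≤ M * N := by
    have : ∀ m ∈ Finset.univ, (∑ i ∈ S, if g m i ≤ 12 * v then (1 : ℝ) else 0) ≤ N := by
      intro m _
      rw [Finset.sum_boole]
      refine le_trans ?_ (hN m)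
      have := card_le_nearOptCount (P := P) (hf m) (h := h) (ε := 12 * v)
        (S := S.filter fun i => g m i ≤ 12 * v)
        (fun i hi => ⟨(hS i (Finset.mem_filter.1 hi).1).1, (Finset.mem_filter.1 hi).2⟩)
      exact_mod_cast this
    simpa using Finset.sum_le_card_nsmul _ _ _ this
  have h3 : (M : ℝ) * (S.card / 2) ≤ M * N := by linarith
  linarith [le_of_mul_le_mul_left h3 hM']

end XArmed

/-! ### Which nodes survive when the estimates are accurate -/

namespace PFPNE

open XArmed

variable {a : Params} {X : Type*}

/-- The standing assumptions on the inputs and the objectives. -/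
structure Setting (P : HierarchicalPartition X a.k) (f : Fin a.M → X → ℝ) : Prop where
  valid : a.Valid
  mem_Icc : ∀ m x, f m x ∈ Set.Icc (0 : ℝ) 1
  lip : ∀ m, WeakLipschitz P a.ν a.ρ (f m)
  lip_avg : WeakLipschitz P a.ν a.ρ (avgObjective f)
  abs_sub_le : ∀ m, |optValue (f m) - optValue (avgObjective f)| ≤ a.Δ

/-- The global estimates of layer `h + 1` are accurate. -/
def GlobalAcc (P : HierarchicalPartition X a.k) (f : Fin a.M → X → ℝ) (y : Rewards a)
    (h : ℕ) : Prop :=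
  ∀ i ∈ serverCand (state y h) (h + 1),
    |globalMean a y (h + 1) i - avgObjective f (P.rep (h + 1) i)| ≤ 5 / 8 * globalWidth a (h + 1)

/-- The local estimates of client `m` of layer `h + 1` are accurate. -/
def LocalAcc (P : HierarchicalPartition X a.k) (f : Fin a.M → X → ℝ) (y : Rewards a)
    (m : Fin a.M) (h : ℕ) : Prop :=
  ∀ i ∈ clientCand (state y h) m,
    |localMean a y m (h + 1) i - f m (P.rep (h + 1) i)| ≤ 5 / 8 * localWidth a (h + 1)

variable {P : HierarchicalPartition X a.k} {f : Fin a.M → X → ℝ} {y : Rewards a}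

lemma Setting.avg_mem_Icc (S : Setting P f) (x : X) : avgObjective f x ∈ Set.Icc (0 : ℝ) 1 :=
  avgObjective_mem_Icc S.valid.M_pos S.mem_Icc x

lemma exists_optNode_children {g : X → ℝ} {h : ℕ} {s : Finset ℕ} (hs : ∀ i ∈ s, i < a.k ^ h)
    (ho : ∃ i ∈ s, OptNode P g h i) : ∃ i ∈ children a s, OptNode P g (h + 1) i := by
  obtain ⟨i, hi, ho⟩ := ho
  obtain ⟨j, hj, ho⟩ := ho.exists_child (hs i hi)
  exact ⟨_, mem_children.2 ⟨i, hi, j, hj, rfl⟩, ho⟩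

/-- A node on the path to the optimum of the global objective survives on the server. -/
lemma exists_optNode_server (S : Setting P f) {h : ℕ} (hg : ∀ j < h, GlobalAcc P f y j)
    (hf : h = 0 ∨ Federated a h) :
    ∃ i ∈ (state y h).server, OptNode P (avgObjective f) h i := by
  have H := S.valid
  induction h with
  | zero => exact ⟨0, by simp [state], optNode_root P _⟩
  | succ h ih =>
    have hf : Federated a (h + 1) := by simpa using hf
    obtain ⟨i, hi, ho⟩ := exists_optNode_children (lt_of_mem_state y h).1
      (ih (fun j hj => hg j (by omega)) (Or.inr (federated_anti H (by omega) hf)))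
    have hlt := lt_of_mem_children (lt_of_mem_state y h).1 hi
    have hc : serverCand (state y h) (h + 1) = children a (state y h).server := if_pos hf
    rw [← hc] at hi
    refine ⟨i, Finset.mem_filter.2 ⟨hi, ?_⟩, ho⟩
    -- The gap of the representative is at most one scale, which the test grants explicitly; the two
    -- estimation errors of 5/8 of a width are covered by the two widths.
    have h1 := S.lip_avg.gap_le_of_optNode H.ν_pos H.ρ_pos hlt ho (P.rep_mem _ _ hlt)
    have h2 := abs_le.1 (hg h (Nat.lt_succ_self h) i hi)
    have hp := (argmax_spec ⟨i, hi⟩ (globalMean a y (h + 1))).1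
    have h3 := abs_le.1 (hg h (Nat.lt_succ_self h) _ hp)
    have h4 := le_optValue S.avg_mem_Icc
      (P.rep (h + 1) (argmax (serverCand (state y h) (h + 1)) (globalMean a y (h + 1))))
    have h5 := globalWidth_nonneg H (h + 1)
    linarith [h2.1, h3.2]

/-- The nodes that the server keeps are near-optimal for the global objective. -/
lemma avg_gap_le_of_mem_server (S : Setting P f) {h : ℕ} (hg : ∀ j < h + 1, GlobalAcc P f y j)
    {i : ℕ} (hi : i ∈ (state y (h + 1)).server) :
    optValue (avgObjective f) - avgObjective f (P.rep (h + 1) i) ≤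
      21 / 4 * (a.ν * a.ρ ^ (h + 1)) := by
  have H := S.valid
  have hf : Federated a (h + 1) := by simpa using eq_zero_or_federated_of_mem_server hi
  obtain ⟨o, ho, hopt⟩ := exists_optNode_server S (y := y) hg (Or.inr hf)
  have hlt := (lt_of_mem_state y (h + 1)).1 o ho
  have ho' := serverKeep_subset _ _ _ ho
  have h1 := S.lip_avg.gap_le_of_optNode H.ν_pos H.ρ_pos hlt hopt (P.rep_mem _ _ hlt)
  have h2 := abs_le.1 (hg h (Nat.lt_succ_self h) o ho')
  have h3 := (argmax_spec ⟨o, ho'⟩ (globalMean a y (h + 1))).2 o ho'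
  have h4 := abs_le.1 (hg h (Nat.lt_succ_self h) i (serverKeep_subset _ _ _ hi))
  have h5 := (Finset.mem_filter.1 hi).2
  have h6 := globalWidth_le H (h + 1)
  push Not at h5
  -- Two scales, one from the optimal node and one from the test, two widths from the test, and two
  -- errors of 5/8 of a width: 2 + 2 + 5/4 = 21/4.
  linarith [h2.1, h4.2]

/-- The values at x average exactly to the global value at x, so heterogeneity enters only through
the optimal values, by at most Δ per client. -/
lemma Setting.sum_gap_le (S : Setting P f) (x : X) :
    ∑ m, (optValue (f m) - f m x) ≤
      a.M * (optValue (avgObjective f) - avgObjective f x + a.Δ) := by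
  have hM : (a.M : ℝ) ≠ 0 := by exact_mod_cast S.valid.M_pos.ne'
  calc ∑ m, (optValue (f m) - f m x)
      ≤ ∑ m, (optValue (avgObjective f) + a.Δ - f m x) := by
        refine Finset.sum_le_sum fun m _ => ?_
        linarith [(abs_le.1 (S.abs_sub_le m)).2]
    _ = _ := by
        rw [Finset.sum_sub_distrib, avgObjective]
        simp only [Finset.sum_const, Finset.card_univ, Fintype.card_fin, nsmul_eq_mul]
        field_simp
        ring

lemma Setting.sum_gap_le_root (S : Setting P f) (x : X) :
    ∑ m, (optValue (f m) - f m x) ≤ a.M * a.ν := by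
  have := Finset.sum_le_card_nsmul Finset.univ (fun m => optValue (f m) - f m x) a.ν
    fun m _ => (S.lip m).gap_le_root S.valid.ν_pos S.valid.ρ_pos x
  simpa using this

lemma scale_of_federated {h : ℕ} (hf : Federated a h) : a.Δ ≤ a.ν * a.ρ ^ h / 4 := by
  unfold Federated at hf
  linarith

/-- The nodes that the server keeps are near-optimal on average over the clients. -/
lemma sum_gap_rep_le_of_mem_server (S : Setting P f) {h : ℕ} (hg : ∀ j < h, GlobalAcc P f y j)
    {i : ℕ} (hi : i ∈ (state y h).server) :
    ∑ m, (optValue (f m) - f m (P.rep h i)) ≤ a.M * (6 * (a.ν * a.ρ ^ h)) := by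
  have hM : (0 : ℝ) ≤ a.M := by positivity
  have hv := S.valid.scale_pos h
  rcases h with _ | h
  · refine (S.sum_gap_le_root _).trans (mul_le_mul_of_nonneg_left ?_ hM)
    simp only [pow_zero, mul_one] at hv ⊢
    linarith
  · have hf : Federated a (h + 1) := by simpa using eq_zero_or_federated_of_mem_server hi
    refine (S.sum_gap_le _).trans (mul_le_mul_of_nonneg_left ?_ hM)
    -- The total is 21/4 + 1/4 scales, below the 6 that Markov's inequality turns into 12.
    linarith [avg_gap_le_of_mem_server S hg hi, scale_of_federated hf]

/-- Smoothness of the averaged objective doubles 21/4 over the cell, and Δ adds 1/4. Working with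
the average first avoids doubling Δ. -/
lemma sum_gap_le_of_mem_server (S : Setting P f) {h : ℕ} (hg : ∀ j < h, GlobalAcc P f y j)
    {i : ℕ} (hi : i ∈ (state y h).server) {x : X} (hx : x ∈ P.cell h i) :
    ∑ m, (optValue (f m) - f m x) ≤ a.M * (11 * (a.ν * a.ρ ^ h)) := by
  have hM : (0 : ℝ) ≤ a.M := by positivity
  have hv := S.valid.scale_pos h
  rcases h with _ | h
  · refine (S.sum_gap_le_root _).trans (mul_le_mul_of_nonneg_left ?_ hM)
    simp only [pow_zero, mul_one] at hv ⊢
    linarith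
  · have hf : Federated a (h + 1) := by simpa using eq_zero_or_federated_of_mem_server hi
    refine (S.sum_gap_le _).trans (mul_le_mul_of_nonneg_left ?_ hM)
    have hlt := (lt_of_mem_state y (h + 1)).1 i hi
    have := S.lip_avg.gap_le hlt (b := 21 / 4 * (a.ν * a.ρ ^ (h + 1))) (by linarith)
      (P.rep_mem _ _ hlt) hx (avg_gap_le_of_mem_server S hg hi)
    linarith [scale_of_federated hf]

lemma clientMean_of_mem {s : State a} {m : Fin a.M} {h i : ℕ} (hi : i ∈ serverKeep y s h) :
    clientMean y s m h i = globalMean a y h i := if_pos hi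

lemma clientMean_of_notMem {s : State a} {m : Fin a.M} {h i : ℕ} (hi : i ∉ serverKeep y s h) :
    clientMean y s m h i = localMean a y m h i := if_neg hi

lemma clientWidth_of_mem {s : State a} {h i : ℕ} (hi : i ∈ serverKeep y s h) :
    clientWidth y s h i = globalWidth a h := if_pos hi

lemma clientWidth_of_notMem {s : State a} {h i : ℕ} (hi : i ∉ serverKeep y s h) :
    clientWidth y s h i = localWidth a h := if_neg hi

/-- A node on the path to the optimum of a local objective survives. -/
lemma exists_optNode_client (S : Setting P f) {h : ℕ} {m : Fin a.M}
    (hg : ∀ j < h, GlobalAcc P f y j) (hl : ∀ j < h, LocalAcc P f y m j) :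
    ∃ i ∈ (state y h).server ∪ (state y h).client m, OptNode P (f m) h i := by
  have H := S.valid
  induction h with
  | zero => exact ⟨0, by simp [state], optNode_root P _⟩
  | succ h ih =>
    have hu : ∀ i ∈ (state y h).server ∪ (state y h).client m, i < a.k ^ h := by
      intro i hi
      rcases Finset.mem_union.1 hi with hi | hi
      exacts [(lt_of_mem_state y h).1 i hi, (lt_of_mem_state y h).2 m i hi]
    obtain ⟨i, hi, ho⟩ := exists_optNode_children hu
      (ih (fun j hj => hg j (by omega)) (fun j hj => hl j (by omega)))
    have hi : i ∈ clientCand (state y h) m := hi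
    refine ⟨i, Finset.mem_union.2 ?_, ho⟩
    by_cases hk : i ∈ serverKeep y (state y h) (h + 1)
    · exact Or.inl hk
    right
    refine Finset.mem_filter.2 ⟨Finset.mem_sdiff.2 ⟨hi, hk⟩, ?_⟩
    have hlt := lt_of_mem_clientCand hi
    have h1 := (S.lip m).gap_le_of_optNode H.ν_pos H.ρ_pos hlt ho (P.rep_mem _ _ hlt)
    have h2 := (abs_le.1 (hl h (Nat.lt_succ_self h) i hi)).1
    have h0 := (S.mem_Icc m (P.rep (h + 1) i)).1
    have hp := clientBest_mem ⟨i, hi⟩ y (h + 1)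
    have hb := localWidth_nonneg H (h + 1)
    rw [clientMean_of_notMem hk, clientWidth_of_notMem hk]
    by_cases hpk : clientBest y (state y h) m (h + 1) ∈ serverKeep y (state y h) (h + 1)
    · rw [clientMean_of_mem hpk, clientWidth_of_mem hpk]
      have hf : Federated a (h + 1) := by
        simpa using eq_zero_or_federated_of_mem_server (h := h + 1) hpk
      have h3 := (abs_le.1 (hg h (Nat.lt_succ_self h) _ (serverKeep_subset _ _ _ hpk))).2
      have h4 := le_optValue S.avg_mem_Icc
        (P.rep (h + 1) (clientBest y (state y h) m (h + 1)))
      have h5 := optValue_le_one P S.avg_mem_Icc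
      have h6 := globalWidth_nonneg H (h + 1)
      have h7 := scale_of_federated hf
      have h8 := (abs_le.1 (S.abs_sub_le m)).1
      -- Here a local estimate is compared with a global one. Either the unused 3/8 of the local
      -- width covers Δ, or the upper confidence value of node i, scale included, is at least 1,
      -- which no lower confidence value of a global estimate exceeds.
      rcases localWidth_slack H (h + 1) with h9 | h9 <;> linarith
    · rw [clientMean_of_notMem hpk, clientWidth_of_notMem hpk]
      have h3 := (abs_le.1 (hl h (Nat.lt_succ_self h) _ hp)).2
      have h4 := le_optValue (S.mem_Icc m) (P.rep (h + 1) (clientBest y (state y h) m (h + 1)))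
      linarith

/-- The nodes that a client keeps beyond those of the server are near-optimal for it. -/
lemma gap_rep_le_of_mem_client (S : Setting P f) {h : ℕ} {m : Fin a.M}
    (hg : ∀ j < h, GlobalAcc P f y j) (hl : ∀ j < h, LocalAcc P f y m j) {i : ℕ}
    (hi : i ∈ (state y h).client m) :
    optValue (f m) - f m (P.rep h i) ≤ 12 * (a.ν * a.ρ ^ h) := by
  have H := S.valid
  rcases h with _ | h
  · simp [state] at hi
  obtain ⟨o, ho, hopt⟩ := exists_optNode_client S hg hl
  have hv := H.scale_pos (h + 1)
  obtain ⟨hi1, hi2⟩ := Finset.mem_filter.1 hi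
  obtain ⟨hic, hik⟩ := Finset.mem_sdiff.1 hi1
  have hoc : o ∈ clientCand (state y h) m := by
    rcases Finset.mem_union.1 ho with ho | ho
    · exact serverCand_subset_clientCand _ _ _ (serverKeep_subset _ _ _ ho)
    · exact (Finset.mem_sdiff.1 (Finset.mem_filter.1 ho).1).1
  have hlt := lt_of_mem_clientCand hoc
  have h1 := (S.lip m).gap_le_of_optNode H.ν_pos H.ρ_pos hlt hopt (P.rep_mem _ _ hlt)
  have h2 := (abs_le.1 (hl h (Nat.lt_succ_self h) i hic)).2
  have h3 := (argmax_spec ⟨o, hoc⟩ (clientMean y (state y h) m (h + 1))).2 o hoc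
  have h4 : clientWidth y (state y h) (h + 1) (clientBest y (state y h) m (h + 1)) ≤
      a.ν * a.ρ ^ (h + 1) := by
    unfold clientWidth
    split_ifs
    exacts [globalWidth_le H _, localWidth_le H _]
  have h5 := localWidth_le H (h + 1)
  push Not at hi2
  rw [clientMean_of_notMem hik, clientWidth_of_notMem hik] at hi2
  change _ ≤ clientMean y (state y h) m (h + 1) (clientBest y (state y h) m (h + 1)) at h3
  by_cases hok : o ∈ serverKeep y (state y h) (h + 1)
  -- The estimate of o is now global, so local optimality of o says nothing about it; that the
  -- server kept o does. The total is 21/4 + 1/4 + 3 + 5/4 = 39/4 scales. In the other case 1 + 3 +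
  -- 5/4 scales suffice.
  · have hf : Federated a (h + 1) := by
      simpa using eq_zero_or_federated_of_mem_server (h := h + 1) hok
    rw [clientMean_of_mem hok] at h3
    have h6 := (abs_le.1 (hg h (Nat.lt_succ_self h) _ (serverKeep_subset _ _ _ hok))).1
    have h7 := avg_gap_le_of_mem_server S hg hok
    have h8 := scale_of_federated hf
    have h9 := (abs_le.1 (S.abs_sub_le m)).2
    have h10 := globalWidth_le H (h + 1)
    linarith
  · rw [clientMean_of_notMem hok] at h3
    have h6 := (abs_le.1 (hl h (Nat.lt_succ_self h) _ hoc)).1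
    linarith

lemma gap_le_of_mem_client (S : Setting P f) {h : ℕ} {m : Fin a.M}
    (hg : ∀ j < h, GlobalAcc P f y j) (hl : ∀ j < h, LocalAcc P f y m j) {i : ℕ}
    (hi : i ∈ (state y h).client m) {x : X} (hx : x ∈ P.cell h i) :
    optValue (f m) - f m x ≤ 24 * (a.ν * a.ρ ^ h) := by
  have hlt := (lt_of_mem_state y h).2 m i hi
  have hv := S.valid.scale_pos h
  have := (S.lip m).gap_le hlt (b := 12 * (a.ν * a.ρ ^ h)) (by linarith) (P.rep_mem _ _ hlt) hx
    (gap_rep_le_of_mem_client S hg hl hi)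
  linarith

/-- The number of nodes that the server keeps. -/
lemma card_server_le (S : Setting P f) {h : ℕ} {N : ℝ}
    (hN : ∀ m, (nearOptCount P (f m) h (12 * (a.ν * a.ρ ^ h)) : ℝ) ≤ N)
    (hg : ∀ j < h, GlobalAcc P f y j) : ((state y h).server.card : ℝ) ≤ 2 * N :=
  card_le_of_sum_gap_le S.valid.M_pos S.mem_Icc (S.valid.scale_pos h) hN fun i hi =>
    ⟨(lt_of_mem_state y h).1 i hi, sum_gap_rep_le_of_mem_server S hg hi⟩

/-- The number of nodes that a client keeps beyond those of the server. -/
lemma card_client_le (S : Setting P f) {h : ℕ} {m : Fin a.M} {N : ℝ}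
    (hN : (nearOptCount P (f m) h (12 * (a.ν * a.ρ ^ h)) : ℝ) ≤ N)
    (hg : ∀ j < h, GlobalAcc P f y j) (hl : ∀ j < h, LocalAcc P f y m j) :
    (((state y h).client m).card : ℝ) ≤ N := by
  refine le_trans ?_ hN
  exact_mod_cast card_le_nearOptCount (S.mem_Icc m) fun i hi =>
    ⟨(lt_of_mem_state y h).2 m i hi, gap_rep_le_of_mem_client S hg hl hi⟩

end PFPNE

namespace PFPNE

open XArmed

variable {a : Params} {X : Type*}

/-! ### Positions in block lists -/

lemma getD_flatMap_replicate (l : List ℕ) {n p : ℕ} (hp : p < l.length * n) :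
    (l.flatMap fun i => List.replicate n i).getD p 0 = l.getD (p / n) 0 := by
  induction l generalizing p with
  | nil => simp at hp
  | cons x l ih =>
    have hn : 0 < n := Nat.pos_of_ne_zero (by rintro rfl; simp at hp)
    rw [List.flatMap_cons]
    by_cases h : p < n
    · rw [List.getD_append _ _ _ _ (by simpa using h), Nat.div_eq_of_lt h, List.getD_replicate _ h]
      simp
    · push Not at h
      rw [List.getD_append_right _ _ _ _ (by simpa using h), List.length_replicate, ih,
        Nat.div_eq_sub_div hn h, List.getD_cons_succ]
      rw [List.length_cons, Nat.succ_mul] at hp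
      omega

lemma blocks_getD {Q : Finset ℕ} {n p : ℕ} (hp : p < (blocks Q n).length) :
    ∃ hj : p / n < (Q.sort (· ≤ ·)).length,
      (blocks Q n).getD p 0 = (Q.sort (· ≤ ·))[p / n] := by
  rw [length_blocks] at hp
  have hj : p / n < (Q.sort (· ≤ ·)).length := by
    rw [Finset.length_sort]
    exact Nat.div_lt_of_lt_mul (by rwa [mul_comm])
  refine ⟨hj, ?_⟩
  rw [blocks, getD_flatMap_replicate _ (by simpa using hp), List.getD_eq_getElem _ _ hj]

/-- Every node of smaller index occupies a full block of n positions before p. -/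
lemma rank_mul_le {Q : Finset ℕ} {n p : ℕ} (hp : p < (blocks Q n).length) :
    (Q.filter (· < (blocks Q n).getD p 0)).card * n ≤ p := by
  obtain ⟨hj, e⟩ := blocks_getD hp
  rw [e]
  refine le_trans (Nat.mul_le_mul_right _ ?_) (Nat.div_mul_le_self p n)
  have hsub : Q.filter (· < (Q.sort (· ≤ ·))[p / n]) ⊆
      (Finset.range (p / n)).image fun i => (Q.sort (· ≤ ·)).getD i 0 := by
    intro z hz
    obtain ⟨hzQ, hzl⟩ := Finset.mem_filter.1 hz
    obtain ⟨i, hi, rfl⟩ := List.getElem_of_mem ((Finset.mem_sort (· ≤ ·)).2 hzQ)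
    have hij : i < p / n := by
      by_contra hcon
      push Not at hcon
      have := (Finset.sortedLT_sort Q).strictMono_get.monotone
        (a := ⟨p / n, hj⟩) (b := ⟨i, hi⟩) hcon
      simp only [List.get_eq_getElem] at this
      omega
    exact Finset.mem_image.2 ⟨i, Finset.mem_range.2 hij, List.getD_eq_getElem _ _ hi⟩
  exact (Finset.card_le_card hsub).trans (Finset.card_image_le.trans (by simp))

/-- The sorted list has no duplicates, so all occurrences of a node lie in one block. -/
lemma div_eq_div_of_blocks_getD_eq {Q : Finset ℕ} {n p q : ℕ} (hp : p < (blocks Q n).length)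
    (hq : q < (blocks Q n).length) (e : (blocks Q n).getD p 0 = (blocks Q n).getD q 0) :
    p / n = q / n := by
  obtain ⟨hj, e₁⟩ := blocks_getD hp
  obtain ⟨hj', e₂⟩ := blocks_getD hq
  rw [e₁, e₂] at e
  exact (List.Nodup.getElem_inj_iff (Finset.sort_nodup Q _)).1 e

/-- Only few nodes of `S` are reached within `T` pulls if every node is pulled `n` times in the
order of the indices. -/
lemma sum_rank_le {S : Finset ℕ} {n T : ℕ} (hn : 0 < n) (hT : 0 < T) :
    ∑ x ∈ S, (if (S.filter (· < x)).card * n < T then min T n else 0) ≤ 2 * T := by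
  rw [← Finset.sum_filter, Finset.sum_const, smul_eq_mul]
  -- Distinct elements have distinct ranks, and an admissible rank is at most (T - 1) / n.
  have hc : (S.filter fun x => (S.filter (· < x)).card * n < T).card ≤ (T - 1) / n + 1 := by
    rw [← Finset.card_range ((T - 1) / n + 1)]
    refine Finset.card_le_card_of_injOn (fun x => (S.filter (· < x)).card) ?_ ?_
    · intro x hx
      have := (Finset.mem_filter.1 hx).2
      simp only [Finset.coe_range, Set.mem_Iio]
      have := (Nat.le_div_iff_mul_le hn).2 (Nat.le_sub_one_of_lt this)
      omega
    · have hlt : ∀ x ∈ S, ∀ x', x < x' → (S.filter (· < x)).card < (S.filter (· < x')).card := by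
        intro x hx x' hxx
        refine Finset.card_lt_card ((Finset.ssubset_iff_of_subset fun z hz => ?_).2 ⟨x, ?_, ?_⟩)
        · simp only [Finset.mem_filter] at hz ⊢
          exact ⟨hz.1, hz.2.trans hxx⟩
        · simp [hx, hxx]
        · simp
      intro x hx x' hx' e
      have hx := (Finset.mem_filter.1 hx).1
      have hx' := (Finset.mem_filter.1 hx').1
      have e : (S.filter (· < x)).card = (S.filter (· < x')).card := e
      rcases lt_trichotomy x x' with h | h | h
      · exact absurd e (hlt x hx x' h).ne
      · exact h
      · exact absurd e (hlt x' hx' x h).ne'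
  calc _ ≤ ((T - 1) / n + 1) * min T n := Nat.mul_le_mul_right _ hc
    _ = (T - 1) / n * min T n + min T n := by ring
    _ ≤ (T - 1) / n * n + T :=
      add_le_add (Nat.mul_le_mul_left _ (min_le_right _ _)) (min_le_left _ _)
    _ ≤ 2 * T := by have := Nat.div_mul_le_self (T - 1) n; omega

/-! ### Summation over layers -/

/-- Read from the deepest layer upwards, the sum is dominated by a geometric series whose first term
is below 1 / u. -/
lemma sum_inv_pow_le {ρ u : ℝ} (hρ : 0 < ρ) (hρ1 : ρ < 1) (hu : 0 < u) {J : Finset ℕ}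
    (hJ : ∀ j ∈ J, u < ρ ^ j) : ∑ j ∈ J, (ρ ^ j)⁻¹ ≤ u⁻¹ / (1 - ρ) := by
  rcases J.eq_empty_or_nonempty with rfl | hne
  · simp only [Finset.sum_empty]
    exact div_nonneg (inv_nonneg.2 hu.le) (by linarith)
  set m := J.max' hne
  have hm := hJ m (J.max'_mem hne)
  have hsub : J ⊆ Finset.range (m + 1) := fun j hj =>
    Finset.mem_range.2 (Nat.lt_succ_of_le (J.le_max' j hj))
  calc ∑ j ∈ J, (ρ ^ j)⁻¹ ≤ ∑ j ∈ Finset.range (m + 1), (ρ ^ j)⁻¹ :=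
        Finset.sum_le_sum_of_subset_of_nonneg hsub fun _ _ _ => by positivity
    _ = ∑ j ∈ Finset.range (m + 1), (ρ ^ m)⁻¹ * ρ ^ j := by
        rw [← Finset.sum_range_reflect]
        refine Finset.sum_congr rfl fun j hj => ?_
        have hj := Finset.mem_range.1 hj
        have : ρ ^ m = ρ ^ (m + 1 - 1 - j) * ρ ^ j := by
          rw [← pow_add]
          congr 1
          omega
        rw [this]
        field_simp
    _ = (ρ ^ m)⁻¹ * ∑ j ∈ Finset.range (m + 1), ρ ^ j := by rw [Finset.mul_sum]
    _ ≤ u⁻¹ * (1 - ρ)⁻¹ := by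
        refine mul_le_mul (inv_anti₀ hu hm.le) ?_ (Finset.sum_nonneg fun _ _ => by positivity)
          (by positivity)
        rw [← tsum_geometric_of_lt_one hρ.le hρ1]
        exact (summable_geometric_of_lt_one hρ.le hρ1).sum_le_tsum _ fun _ _ => by positivity
    _ = u⁻¹ / (1 - ρ) := rfl

/-- The threshold `T ^ (-1 / (D + 2))` that balances the two bounds on the regret of a layer. -/
lemma threshold_spec {T D : ℝ} (hT : 1 ≤ T) (hD : 0 ≤ D) :
    0 < T ^ (-1 / (D + 2)) ∧ T * T ^ (-1 / (D + 2)) = T ^ ((D + 1) / (D + 2)) ∧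
      (T ^ (-1 / (D + 2))) ^ (-(D + 1)) = T ^ ((D + 1) / (D + 2)) := by
  have hT0 : 0 < T := by linarith
  have hD2 : D + 2 ≠ 0 := by positivity
  refine ⟨by positivity, ?_, ?_⟩
  · nth_rw 1 [← Real.rpow_one T]
    rw [← Real.rpow_add hT0]
    congr 1
    field_simp
    ring
  · rw [← Real.rpow_mul hT0.le]
    congr 1
    field_simp

lemma mul_rpow_le_of_lt {x u B D : ℝ} (hu : 0 < u) (hx : u < x) (hB : 0 ≤ B) (hD : 0 ≤ D) :
    B * x ^ (-(D + 2)) * x ≤ B * u ^ (-(D + 1)) := by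
  have hx0 : 0 < x := hu.trans hx
  have e : x ^ (-(D + 2)) * x = x ^ (-(D + 1)) := by
    nth_rw 2 [← Real.rpow_one x]
    rw [← Real.rpow_add hx0]
    congr 1
    ring
  rw [mul_assoc, e]
  exact mul_le_mul_of_nonneg_left
    (Real.rpow_le_rpow_of_nonpos hu hx.le (by linarith)) hB

/-- Here `g t` is the layer of round t. Rounds with scale at most u cost at most T u in total. For
the coarser layers the length bound is used, and their costs grow geometrically with depth until the
scale reaches u. -/
lemma sum_pow_layer_le {ρ B D : ℝ} (hρ : 0 < ρ) (hρ1 : ρ < 1) (hB : 0 ≤ B) (hD : 0 ≤ D) {T : ℕ}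
    (hT : 1 ≤ T) (g : ℕ → ℕ)
    (hg : ∀ j, (((Finset.range T).filter fun t => g t = j).card : ℝ) ≤ B * (ρ ^ j) ^ (-(D + 2))) :
    ∑ t ∈ Finset.range T, ρ ^ g t ≤ (1 + B / (1 - ρ)) * (T : ℝ) ^ ((D + 1) / (D + 2)) := by
  classical
  have hT1 : (1 : ℝ) ≤ T := by exact_mod_cast hT
  obtain ⟨hu, hu1, hu2⟩ := threshold_spec hT1 hD
  set u := (T : ℝ) ^ (-1 / (D + 2))
  rw [← Finset.sum_filter_add_sum_filter_not (Finset.range T) (fun t => ρ ^ g t ≤ u), add_mul,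
    one_mul]
  refine add_le_add ?_ ?_
  · rw [← hu1]
    refine (Finset.sum_le_card_nsmul _ _ u fun t ht => (Finset.mem_filter.1 ht).2).trans ?_
    rw [nsmul_eq_mul]
    refine mul_le_mul_of_nonneg_right ?_ hu.le
    exact_mod_cast (Finset.card_filter_le _ _).trans (by simp)
  · set F := (Finset.range T).filter fun t => ¬ ρ ^ g t ≤ u
    have hJ : ∀ j ∈ F.image g, u < ρ ^ j := by
      intro j hj
      obtain ⟨t, ht, rfl⟩ := Finset.mem_image.1 hj
      exact not_le.1 (Finset.mem_filter.1 ht).2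
    rw [← Finset.sum_fiberwise_of_maps_to (t := F.image g)
      (fun t ht => Finset.mem_image_of_mem g ht)]
    -- Only the power -D is replaced by its value at u. The remaining inverse is summed
    -- geometrically, so the constant does not depend on D.
    have hterm : ∀ j ∈ F.image g, ∑ t ∈ F with g t = j, ρ ^ g t ≤ B * u ^ (-D) * (ρ ^ j)⁻¹ := by
      intro j hj
      have hpj : 0 < ρ ^ j := by positivity
      calc ∑ t ∈ F with g t = j, ρ ^ g t = ∑ t ∈ F with g t = j, ρ ^ j :=
            Finset.sum_congr rfl fun t ht => by rw [(Finset.mem_filter.1 ht).2]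
        _ = ((F.filter fun t => g t = j).card : ℝ) * ρ ^ j := by rw [Finset.sum_const, nsmul_eq_mul]
        _ ≤ (B * (ρ ^ j) ^ (-(D + 2))) * ρ ^ j := by
            refine mul_le_mul_of_nonneg_right ((hg j).trans' ?_) hpj.le
            exact_mod_cast Finset.card_le_card
              (Finset.filter_subset_filter _ (Finset.filter_subset _ _))
        _ = B * ((ρ ^ j) ^ (-D) * (ρ ^ j)⁻¹) := by
            rw [← Real.rpow_neg_one (ρ ^ j), mul_assoc, ← Real.rpow_add hpj]
            nth_rw 2 [← Real.rpow_one (ρ ^ j)]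
            rw [← Real.rpow_add hpj]
            congr 2
            ring
        _ ≤ B * u ^ (-D) * (ρ ^ j)⁻¹ := by
            rw [mul_assoc]
            refine mul_le_mul_of_nonneg_left (mul_le_mul_of_nonneg_right ?_ (by positivity)) hB
            exact Real.rpow_le_rpow_of_nonpos hu (hJ j hj).le (by linarith)
    refine (Finset.sum_le_sum hterm).trans ?_
    rw [← Finset.mul_sum]
    calc B * u ^ (-D) * ∑ j ∈ F.image g, (ρ ^ j)⁻¹ ≤ B * u ^ (-D) * (u⁻¹ / (1 - ρ)) :=
          mul_le_mul_of_nonneg_left (sum_inv_pow_le hρ hρ1 hu hJ) (by positivity)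
      _ = B / (1 - ρ) * (u ^ (-D) * u ^ (-1 : ℝ)) := by rw [Real.rpow_neg_one]; ring
      _ = B / (1 - ρ) * (T : ℝ) ^ ((D + 1) / (D + 2)) := by
          rw [← Real.rpow_add hu, ← hu2]
          congr 2
          ring

end PFPNE

/-! ### Regret of a round on the good event -/

namespace PFPNE

open XArmed

variable {a : Params} {X : Type*}

/-- The event on which all estimates that can matter within the horizon are accurate. -/
def Good (P : HierarchicalPartition X a.k) (f : Fin a.M → X → ℝ) (y : Rewards a) : Prop :=
  ∀ h < a.T, ((serverCand (state y h) (h + 1)).card ≤ a.T → GlobalAcc P f y h) ∧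
    ∀ m, (clientCand (state y h) m).card ≤ a.T → LocalAcc P f y m h

/-- The gap of the node `q` for client `m`. -/
def gap (P : HierarchicalPartition X a.k) (f : Fin a.M → X → ℝ) (m : Fin a.M) (q : ℕ × ℕ) : ℝ :=
  optValue (f m) - f m (P.rep q.1 q.2)

variable {P : HierarchicalPartition X a.k} {f : Fin a.M → X → ℝ} {y : Rewards a}

lemma gap_nonneg (S : Setting P f) (m : Fin a.M) (q : ℕ × ℕ) : 0 ≤ gap P f m q :=
  sub_nonneg.2 (le_optValue (S.mem_Icc m) _)

lemma gap_le_one (S : Setting P f) (m : Fin a.M) (q : ℕ × ℕ) : gap P f m q ≤ 1 := by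
  have h1 := optValue_le_one P (S.mem_Icc m)
  have h2 := (S.mem_Icc m (P.rep q.1 q.2)).1
  unfold gap
  linarith

/-- Every candidate is pulled at least once, so a layer whose sampling is completed within the
horizon has at most T candidates; likewise each earlier layer takes a round, so h < T. Both
restrictions in `Good` are thus met. -/
lemma Good.acc_of_done (S : Setting P f) (G : Good P f y) {m : Fin a.M} {h : ℕ}
    (hd : start y m h + (sharedPulls y (state y h) (h + 1) ++
      ownPulls (state y h) m (h + 1)).length < a.T) : GlobalAcc P f y h ∧ LocalAcc P f y m h := by
  have H := S.valid
  have h1 := card_clientCand_le H y (state y h) m (h + 1)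
  have h2 := Finset.card_le_card (serverCand_subset_clientCand (state y h) m (h + 1))
  have h3 : h ≤ start y m h := (start_strictMono H y m).le_apply
  exact ⟨(G h (by omega)).1 (by omega), (G h (by omega)).2 m (by omega)⟩

lemma Good.acc_of_lt (S : Setting P f) (G : Good P f y) {m : Fin a.M} {t : ℕ} (ht : t < a.T)
    {j : ℕ} (hj : j < layerIdx y m t) : GlobalAcc P f y j ∧ LocalAcc P f y m j := by
  have H := S.valid
  refine G.acc_of_done S ?_
  have h1 := (layerIdx_spec H y m t).1
  have h2 := (start_strictMono H y m).monotone (Nat.succ_le_of_lt hj)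
  rw [start_succ, layerPulls, List.length_append (bs := List.replicate _ _)] at h2
  omega

lemma gap_le_of_mem_children_client (S : Setting P f) {h : ℕ} {m : Fin a.M}
    (hg : ∀ j < h, GlobalAcc P f y j ∧ LocalAcc P f y m j) {i : ℕ}
    (hi : i ∈ children a ((state y h).client m)) :
    gap P f m (h + 1, i) ≤ 24 * (a.ν * a.ρ ^ h) := by
  obtain ⟨p, hp, j, hj, rfl⟩ := mem_children.1 hi
  exact gap_le_of_mem_client S (fun j hj => (hg j hj).1) (fun j hj => (hg j hj).2) hp
    (rep_child_mem P ((lt_of_mem_state y h).2 m p hp) hj)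

lemma sum_gap_le_of_mem_children_server (S : Setting P f) {h : ℕ}
    (hg : ∀ j < h, GlobalAcc P f y j) {i : ℕ} (hi : i ∈ children a (state y h).server) :
    ∑ m, gap P f m (h + 1, i) ≤ a.M * (11 * (a.ν * a.ρ ^ h)) := by
  obtain ⟨p, hp, j, hj, rfl⟩ := mem_children.1 hi
  exact sum_gap_le_of_mem_server S hg hp (rep_child_mem P ((lt_of_mem_state y h).1 p hp) hj)

/-- In a round of a federated layer, every client pulls the same node of the server, or a node that
is near-optimal for itself. -/
lemma exists_common_node (S : Setting P f) (G : Good P f y) {m₀ : Fin a.M} {t h : ℕ} (ht : t < a.T)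
    (hh : layerIdx y m₀ t = h) (hf : Federated a (h + 1)) :
    ∃ z ∈ children a (state y h).server, ∀ m, nodeAt y m t = (h + 1, z) ∨
      gap P f m (nodeAt y m t) ≤ 24 * (a.ν * a.ρ ^ h) := by
  classical
  have H := S.valid
  have hidx : ∀ m, layerIdx y m t = h := fun m => by
    rw [layerIdx_eq_of_federated H (m := m₀) (by rwa [hh]), hh]
  have hacc : ∀ m, ∀ j < h, GlobalAcc P f y j ∧ LocalAcc P f y m j := fun m j hj =>
    G.acc_of_lt S ht (by rwa [hidx m])
  have hst : ∀ m, start y m h = start y m₀ h := fun m =>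
    start_eq_of_federated H y m m₀ (Or.inr (federated_anti H (Nat.le_succ h) hf))
  have hs1 : start y m₀ h ≤ t := hh ▸ (layerIdx_spec H y m₀ t).1
  have hs2 : ∀ m, t - start y m₀ h < (layerPulls y (state y h) m (h + 1)).length := fun m => by
    have := (layerIdx_spec H y m t).2
    rw [hidx, start_succ, hst] at this
    omega
  have hnode : ∀ m, nodeAt y m t =
      (h + 1, (layerPulls y (state y h) m (h + 1)).getD (t - start y m₀ h) 0) := fun m => by
    rw [nodeAt_eq H, hidx, hst]
  have hc : serverCand (state y h) (h + 1) = children a (state y h).server := if_pos hf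
  set p := t - start y m₀ h
  set sh := sharedPulls y (state y h) (h + 1) with hsh
  -- Since all clients entered the layer together, equal positions in the shared list mean equal
  -- nodes.
  by_cases hp : p < sh.length
  · refine ⟨sh[p], ?_, fun m => Or.inl ?_⟩
    · have := List.getElem_mem hp
      rw [← hc]
      rcases List.mem_append.1 this with h1 | h1
      · exact mem_of_mem_blocks h1
      · exact (Finset.mem_sdiff.1 (mem_of_mem_blocks h1)).1
    · rw [hnode, layerPulls, List.append_assoc, List.getD_append _ _ _ _ hp,
        List.getD_eq_getElem _ _ hp]
  push Not at hp
  set own : Fin a.M → List ℕ := fun m => ownPulls (state y h) m (h + 1)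
  have hown : ∀ m, p < (sh ++ own m).length →
      gap P f m (nodeAt y m t) ≤ 24 * (a.ν * a.ρ ^ h) := by
    intro m hm
    have hm' : p - sh.length < (own m).length := by
      rw [List.length_append] at hm
      omega
    rw [hnode, layerPulls, List.getD_append _ _ _ _ hm, List.getD_append_right _ _ _ _ hp,
      List.getD_eq_getElem _ _ hm']
    refine gap_le_of_mem_children_client S (hacc m) (clientCand_sdiff_subset _ m hf ?_)
    exact mem_of_mem_blocks (List.getElem_mem hm')
  have hwait : ∀ m, (sh ++ own m).length ≤ p →
      nodeAt y m t = (h + 1, clientBest y (state y h) m (h + 1)) := by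
    intro m hm
    have := hs2 m
    rw [layerPulls, List.length_append] at this
    change p < (sh ++ own m).length + _ at this
    have hlt : p - (sh ++ own m).length < (List.replicate (waitingTime (state y h) m (h + 1))
        (clientBest y (state y h) m (h + 1))).length := by omega
    rw [hnode, layerPulls, List.getD_append_right _ _ _ _ hm, List.getD_eq_getElem _ _ hlt]
    simp
  -- A waiting client has finished sampling the layer, so its estimates of this very layer are
  -- accurate too. A best node that the server eliminated is kept by the client itself, hence
  -- near-optimal for it.
  have hwait' : ∀ m, (sh ++ own m).length ≤ p →
      clientBest y (state y h) m (h + 1) ∉ serverKeep y (state y h) (h + 1) →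
      gap P f m (nodeAt y m t) ≤ 24 * (a.ν * a.ρ ^ h) := by
    intro m hm hb
    have hkeep : clientBest y (state y h) m (h + 1) ∈ (state y (h + 1)).client m :=
      clientBest_mem_keep H (clientCand_nonempty H y m h) y (h + 1) hb
    have hlast : GlobalAcc P f y h ∧ LocalAcc P f y m h := by
      refine G.acc_of_done S ?_
      have := hst m
      change start y m h + (sh ++ own m).length < a.T
      omega
    have hacc' : ∀ j < h + 1, GlobalAcc P f y j ∧ LocalAcc P f y m j := by
      intro j hj
      rcases Nat.lt_succ_iff_lt_or_eq.1 hj with hj | rfl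
      exacts [hacc m j hj, hlast]
    rw [hwait m hm]
    refine (gap_rep_le_of_mem_client S (fun j hj => (hacc' j hj).1)
      (fun j hj => (hacc' j hj).2) hkeep).trans ?_
    have h1 : a.ρ ^ (h + 1) ≤ a.ρ ^ h :=
      pow_le_pow_of_le_one H.ρ_pos.le H.ρ_lt_one.le (Nat.le_succ h)
    have h2 := mul_le_mul_of_nonneg_left h1 H.ν_pos.le
    linarith [H.scale_pos h]
  -- Waiting clients whose best node belongs to the server all pull the same one. If no client has
  -- such a best node, any server node serves as z.
  by_cases hex : ∃ m, clientBest y (state y h) m (h + 1) ∈ serverKeep y (state y h) (h + 1)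
  · obtain ⟨m₁, hm₁⟩ := hex
    refine ⟨clientBest y (state y h) m₁ (h + 1), hc ▸ serverKeep_subset _ _ _ hm₁, fun m => ?_⟩
    rcases lt_or_ge p (sh ++ own m).length with hm | hm
    · exact Or.inr (hown m hm)
    · by_cases hb : clientBest y (state y h) m (h + 1) ∈ serverKeep y (state y h) (h + 1)
      · exact Or.inl (by rw [hwait m hm, clientBest_eq y hb hm₁])
      · exact Or.inr (hwait' m hm hb)
  · push Not at hex
    obtain ⟨z, hz⟩ := children_nonempty H.k_pos
      (server_nonempty H y h (Or.inr (federated_anti H (Nat.le_succ h) hf)))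
    refine ⟨z, hz, fun m => Or.inr ?_⟩
    rcases lt_or_ge p (sh ++ own m).length with hm | hm
    · exact hown m hm
    · exact hwait' m hm (hex m)

open scoped Classical in
/-- The gap of client `m` in round `t` if it pulls on its own a node that the server has handed
over, and `0` otherwise. -/
def handoverGap (P : HierarchicalPartition X a.k) (f : Fin a.M → X → ℝ) (y : Rewards a)
    (m : Fin a.M) (t : ℕ) : ℝ :=
  if ¬ Federated a (layerIdx y m t + 1) ∧
      (nodeAt y m t).2 ∈ children a (state y (layerIdx y m t)).server
  then gap P f m (nodeAt y m t) else 0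

lemma handoverGap_nonneg (S : Setting P f) (m : Fin a.M) (t : ℕ) : 0 ≤ handoverGap P f y m t := by
  unfold handoverGap
  split_ifs
  exacts [gap_nonneg S _ _, le_rfl]

lemma nodeAt_snd_mem (H : a.Valid) (y : Rewards a) (m : Fin a.M) (t : ℕ) :
    (nodeAt y m t).2 ∈ clientCand (state y (layerIdx y m t)) m := by
  obtain ⟨h1, h2⟩ := layerIdx_spec H y m t
  rw [start_succ] at h2
  rw [nodeAt_eq H]
  have hlt : t - start y m (layerIdx y m t) < (layerPulls y (state y (layerIdx y m t)) m
    (layerIdx y m t + 1)).length := by omega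
  refine mem_clientCand_of_mem_layerPulls (y := y) (h := layerIdx y m t + 1)
    (clientCand_nonempty H y m _) ?_
  change List.getD _ _ _ ∈ _
  rw [List.getD_eq_getElem _ _ hlt]
  exact List.getElem_mem _

/-- In a federated round, each client pays 24 scales for a node of its own or its gap at the common
node, and the latter gaps average at most 11 scales; hence 35. Otherwise no client is in a federated
layer, and the server nodes are set aside as handover cost. -/
lemma sum_gap_nodeAt_le (S : Setting P f) (G : Good P f y) {t : ℕ} (ht : t < a.T) :
    ∑ m, gap P f m (nodeAt y m t) ≤
      ∑ m, 35 * (a.ν * a.ρ ^ layerIdx y m t) + ∑ m, handoverGap P f y m t := by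
  have H := S.valid
  by_cases hex : ∃ m₀, Federated a (layerIdx y m₀ t + 1)
  · obtain ⟨m₀, hf⟩ := hex
    set h := layerIdx y m₀ t with hh
    obtain ⟨z, hz, hzn⟩ := exists_common_node S G ht hh.symm hf
    have hidx : ∀ m, layerIdx y m t = h := fun m => layerIdx_eq_of_federated H hf m
    have h1 : ∀ m, gap P f m (nodeAt y m t) ≤ 24 * (a.ν * a.ρ ^ h) + gap P f m (h + 1, z) := by
      intro m
      have := H.scale_pos h
      have := gap_nonneg S m (h + 1, z)
      rcases hzn m with e | e
      · rw [e]
        linarith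
      · linarith
    have h2 := sum_gap_le_of_mem_children_server S
      (fun j hj => (G.acc_of_lt S ht (m := m₀) hj).1) hz
    have h3 : 0 ≤ ∑ m, handoverGap P f y m t := Finset.sum_nonneg fun m _ => handoverGap_nonneg S m t
    have h4 := Finset.sum_le_sum fun m (_ : m ∈ Finset.univ) => h1 m
    simp only [hidx]
    rw [Finset.sum_add_distrib] at h4
    simp only [Finset.sum_const, Finset.card_univ, Fintype.card_fin, nsmul_eq_mul] at h4 ⊢
    linarith
  · push Not at hex
    rw [← Finset.sum_add_distrib]
    refine Finset.sum_le_sum fun m _ => ?_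
    have hv := H.scale_pos (layerIdx y m t)
    have h0 := handoverGap_nonneg (P := P) (f := f) (y := y) S m t
    by_cases hs : (nodeAt y m t).2 ∈ children a (state y (layerIdx y m t)).server
    · rw [handoverGap, if_pos ⟨hex m, hs⟩]
      linarith
    · have hmem := nodeAt_snd_mem H y m t
      rw [clientCand, children_union, Finset.mem_union] at hmem
      have := gap_le_of_mem_children_client S (fun j hj => G.acc_of_lt S ht (m := m) hj)
        (hmem.resolve_left hs)
      rw [show (layerIdx y m t + 1, (nodeAt y m t).2) = nodeAt y m t by rw [nodeAt_eq H]] at this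
      linarith

/-! ### Length of the layers -/

/-- A bound on the sampling threshold of layer `h + 1` at scale `ρ ^ h`. -/
lemma tau_succ_le (H : a.Valid) (h : ℕ) :
    (tau a (h + 1) : ℝ) ≤
      (a.c ^ 2 * logTerm a / a.ν ^ 2 + 1) / a.ρ ^ 2 * (a.ρ ^ h) ^ (-2 : ℝ) := by
  have hL := H.logTerm_pos
  have hc := H.c_pos
  have hν := H.ν_pos
  have hρ := H.ρ_pos
  have hp : 0 < a.ρ ^ (2 * (h + 1)) := by positivity
  have h1 : (tau a (h + 1) : ℝ) ≤ a.c ^ 2 * logTerm a / (a.ν ^ 2 * a.ρ ^ (2 * (h + 1))) + 1 :=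
    (Nat.ceil_lt_add_one (by positivity)).le
  -- The 1 lost by rounding up is absorbed into the same power of ρ.
  have h2 : (1 : ℝ) ≤ 1 / a.ρ ^ (2 * (h + 1)) :=
    (one_le_div hp).2 (pow_le_one₀ hρ.le H.ρ_lt_one.le)
  have e : (a.ρ ^ h) ^ (-2 : ℝ) = 1 / (a.ρ ^ h) ^ 2 := by
    rw [Real.rpow_neg (by positivity), one_div]
    norm_cast
  calc (tau a (h + 1) : ℝ) ≤ a.c ^ 2 * logTerm a / (a.ν ^ 2 * a.ρ ^ (2 * (h + 1))) +
        1 / a.ρ ^ (2 * (h + 1)) := by linarith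
    _ = _ := by
        rw [e]
        field_simp
        ring

/-- The number of nodes in question at depth `h`, times the sampling threshold of layer `h + 1`. -/
lemma count_mul_tau_le (H : a.Valid) {C D : ℝ} (hC : 0 ≤ C) (h : ℕ) :
    3 * a.k * (C * (a.ρ ^ h) ^ (-D)) * tau a (h + 1) ≤
      3 * a.k * C * ((a.c ^ 2 * logTerm a / a.ν ^ 2 + 1) / a.ρ ^ 2) *
        (a.ρ ^ h) ^ (-(D + 2)) := by
  have hp : 0 < a.ρ ^ h := pow_pos H.ρ_pos h
  have e : (a.ρ ^ h) ^ (-(D + 2)) = (a.ρ ^ h) ^ (-D) * (a.ρ ^ h) ^ (-2 : ℝ) := by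
    rw [← Real.rpow_add hp]
    congr 1
    ring
  rw [e]
  have := mul_le_mul_of_nonneg_left (tau_succ_le H h)
    (by positivity : 0 ≤ 3 * a.k * (C * (a.ρ ^ h) ^ (-D)))
  linarith

/-- The parents are at most 2 N server nodes and N nodes of one client, each with k children. In a
federated layer that client is the slowest one; it is in the same layer at round t, so its earlier
estimates are accurate as well. -/
lemma length_layerPulls_le (S : Setting P f) (G : Good P f y) {m : Fin a.M} {t h : ℕ} {N : ℝ}
    (hN : ∀ m, (nearOptCount P (f m) h (12 * (a.ν * a.ρ ^ h)) : ℝ) ≤ N)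
    (ht : t < a.T) (hh : layerIdx y m t = h) :
    ((layerPulls y (state y h) m (h + 1)).length : ℝ) ≤ 3 * a.k * N * tau a (h + 1) := by
  have H := S.valid
  have hg : ∀ j < h, GlobalAcc P f y j := fun j hj => (G.acc_of_lt S ht (by rwa [hh])).1
  have hs := card_server_le S hN hg
  have hks : ((children a (state y h).server).card : ℝ) ≤ a.k * (2 * N) := by
    have : ((children a (state y h).server).card : ℝ) ≤ a.k * (state y h).server.card := by
      exact_mod_cast card_children_le _
    exact this.trans (mul_le_mul_of_nonneg_left hs (by positivity))
  have hkc : ∀ m', (∀ j < h, LocalAcc P f y m' j) →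
      ((children a ((state y h).client m')).card : ℝ) ≤ a.k * N := by
    intro m' hl
    have : ((children a ((state y h).client m')).card : ℝ) ≤
        a.k * ((state y h).client m').card := by exact_mod_cast card_children_le _
    exact this.trans (mul_le_mul_of_nonneg_left (card_client_le S (hN m') hg hl) (by positivity))
  have hτ : (0 : ℝ) ≤ tau a (h + 1) := by positivity
  by_cases hf : Federated a (h + 1)
  · rw [length_layerPulls_of_federated _ _ _ hf]
    obtain ⟨m', -, hm'⟩ := Finset.exists_mem_eq_sup Finset.univ ⟨m, Finset.mem_univ m⟩
      fun m' : Fin a.M => (ownPulls (state y h) m' (h + 1)).length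
    rw [hm', Nat.cast_add]
    have h1 : ((sharedPulls y (state y h) (h + 1)).length : ℝ) ≤
        (children a (state y h).server).card * tau a (h + 1) := by
      have := length_sharedPulls_le H y (state y h) (h + 1)
      rw [show serverCand (state y h) (h + 1) = _ from if_pos hf] at this
      exact_mod_cast this
    have h2 : ((ownPulls (state y h) m' (h + 1)).length : ℝ) ≤
        (children a ((state y h).client m')).card * tau a (h + 1) := by
      rw [ownPulls, length_blocks]
      exact_mod_cast Nat.mul_le_mul_right _
        (Finset.card_le_card (clientCand_sdiff_subset (state y h) m' hf))
    have hidx : layerIdx y m' t = h := by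
      rw [layerIdx_eq_of_federated H (m := m) (by rwa [hh]), hh]
    have h3 := hkc m' fun j hj => (G.acc_of_lt S ht (by rwa [hidx])).2
    have h4 := mul_le_mul_of_nonneg_right hks hτ
    have h5 := mul_le_mul_of_nonneg_right h3 hτ
    linarith
  · rw [layerPulls_of_not_federated _ _ _ hf, length_blocks, Nat.cast_mul]
    refine mul_le_mul_of_nonneg_right ?_ hτ
    have h1 : ((clientCand (state y h) m).card : ℝ) ≤
        (children a (state y h).server).card + (children a ((state y h).client m)).card := by
      rw [clientCand, children_union]
      exact_mod_cast Finset.card_union_le _ _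
    have h2 := hkc m fun j hj => (G.acc_of_lt S ht (by rwa [hh])).2
    linarith

lemma card_layerIdx_eq_le (H : a.Valid) (y : Rewards a) (m : Fin a.M) (h : ℕ) :
    ((Finset.range a.T).filter fun t => layerIdx y m t = h).card ≤
      (layerPulls y (state y h) m (h + 1)).length := by
  have hsub : ((Finset.range a.T).filter fun t => layerIdx y m t = h) ⊆
      Finset.Ico (start y m h) (start y m (h + 1)) := by
    intro t ht
    have h1 := layerIdx_spec H y m t
    rw [(Finset.mem_filter.1 ht).2] at h1
    exact Finset.mem_Ico.2 h1
  refine (Finset.card_le_card hsub).trans ?_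
  rw [Nat.card_Ico, start_succ]
  omega

/-- The constant in the bound on the length of the layers. -/
def layerConst (a : Params) (C : ℝ) : ℝ :=
  3 * a.k * C * ((a.c ^ 2 * logTerm a / a.ν ^ 2 + 1) / a.ρ ^ 2)

lemma layerConst_nonneg (H : a.Valid) {C : ℝ} (hC : 0 ≤ C) : 0 ≤ layerConst a C := by
  have := H.logTerm_pos
  unfold layerConst
  positivity

lemma sum_pow_layerIdx_le (S : Setting P f) (G : Good P f y) {C D : ℝ} (hC : 0 ≤ C) (hD : 0 ≤ D)
    (hN : ∀ h m, (nearOptCount P (f m) h (12 * (a.ν * a.ρ ^ h)) : ℝ) ≤ C * (a.ρ ^ h) ^ (-D))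
    (m : Fin a.M) : ∑ t ∈ Finset.range a.T, a.ρ ^ layerIdx y m t ≤
      (1 + layerConst a C / (1 - a.ρ)) * (a.T : ℝ) ^ ((D + 1) / (D + 2)) := by
  have H := S.valid
  refine sum_pow_layer_le H.ρ_pos H.ρ_lt_one (layerConst_nonneg H hC) hD H.T_pos _ fun h => ?_
  -- The length bound is available only for layers that are reached within the horizon; the others
  -- contribute no round.
  rcases ((Finset.range a.T).filter fun t => layerIdx y m t = h).eq_empty_or_nonempty with e | ⟨t, ht⟩
  · rw [e, Finset.card_empty, Nat.cast_zero]
    have := layerConst_nonneg H hC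
    have := H.ρ_pos
    positivity
  · obtain ⟨ht1, ht2⟩ := Finset.mem_filter.1 ht
    refine le_trans ?_ (count_mul_tau_le H hC h)
    refine le_trans ?_ (length_layerPulls_le S G (hN h) (Finset.mem_range.1 ht1) ht2)
    exact_mod_cast card_layerIdx_eq_le H y m h

/-! ### The layer after the federated ones -/

/-- A client pulls a node of the first separate layer only when it has pulled all nodes of the
server with a smaller index `τ` times each. -/
lemma card_nodeAt_eq_le (H : a.Valid) {y : Rewards a} {h : ℕ} (hf : ¬ Federated a (h + 1))
    (m : Fin a.M) (x : ℕ) :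
    ((Finset.range a.T).filter fun t => layerIdx y m t = h ∧ (nodeAt y m t).2 = x).card ≤
      if ((children a (state y h).server).filter (· < x)).card * tau a (h + 1) < a.T
      then min a.T (tau a (h + 1)) else 0 := by
  set F := (Finset.range a.T).filter fun t => layerIdx y m t = h ∧ (nodeAt y m t).2 = x
  set Q := clientCand (state y h) m
  set n := tau a (h + 1)
  set s := start y m h
  have key : ∀ t ∈ F, t < a.T ∧ s ≤ t ∧ t - s < (blocks Q n).length ∧
      (blocks Q n).getD (t - s) 0 = x := by
    intro t ht
    obtain ⟨h1, h2, h3⟩ := Finset.mem_filter.1 ht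
    obtain ⟨h4, h5⟩ := layerIdx_spec H y m t
    rw [h2] at h4 h5
    rw [start_succ, layerPulls_of_not_federated _ _ _ hf] at h5
    rw [nodeAt_eq H, h2, layerPulls_of_not_federated _ _ _ hf] at h3
    have h6 : t < s + (blocks Q n).length := h5
    exact ⟨Finset.mem_range.1 h1, h4, by omega, h3⟩
  rcases F.eq_empty_or_nonempty with e | ⟨t₀, ht₀⟩
  · simp [e]
  obtain ⟨h1, h2, h3, h4⟩ := key t₀ ht₀
  rw [if_pos]
  · refine le_min ((Finset.card_filter_le _ _).trans (by simp)) ?_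
    have hn : 0 < n := tau_pos H _
    -- All pulls of x lie in the block of n rounds that contains the pull at t₀.
    have hsub : F ⊆ Finset.Ico (s + (t₀ - s) / n * n) (s + (t₀ - s) / n * n + n) := by
      intro t ht
      obtain ⟨k1, k2, k3, k4⟩ := key t ht
      have e := div_eq_div_of_blocks_getD_eq k3 h3 (k4.trans h4.symm)
      have e1 := Nat.div_add_mod' (t - s) n
      have e2 := Nat.mod_lt (t - s) hn
      rw [← e]
      exact Finset.mem_Ico.2 ⟨by omega, by omega⟩
    refine (Finset.card_le_card hsub).trans ?_
    rw [Nat.card_Ico]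
    omega
  · have h5 := rank_mul_le h3
    rw [h4] at h5
    -- The client's additional nodes can only delay x, so the rank among server nodes alone gives a
    -- necessary condition that is the same for all clients.
    have h6 : ((children a (state y h).server).filter (· < x)).card ≤ (Q.filter (· < x)).card := by
      refine Finset.card_le_card (Finset.filter_subset_filter _ ?_)
      exact children_mono Finset.subset_union_left
    have := Nat.mul_le_mul_right n h6
    omega

/-- Below the root the server has nodes only at federated depths, so it hands nodes over only to the
first layer that is not federated. -/
lemma layer_eq_of_handover (H : a.Valid) {y : Rewards a} {h h' i i' : ℕ}
    (hf : ¬ Federated a (h + 1)) (hf' : ¬ Federated a (h' + 1))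
    (hi : i ∈ children a (state y h).server) (hi' : i' ∈ children a (state y h').server) :
    h = h' := by
  obtain ⟨p, hp, -⟩ := mem_children.1 hi
  obtain ⟨p', hp', -⟩ := mem_children.1 hi'
  rcases lt_trichotomy h h' with hlt | hlt | hlt
  · exact absurd (federated_anti H hlt
      ((eq_zero_or_federated_of_mem_server hp').resolve_left (by omega))) hf
  · exact hlt
  · exact absurd (federated_anti H hlt
      ((eq_zero_or_federated_of_mem_server hp).resolve_left (by omega))) hf'

/-- Only one layer is involved, but the clients may pull different server nodes in the same round.
Bounding the number of pulls per node uniformly in the client lets the gaps at each node be summed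
over the clients first. -/
lemma sum_handoverGap_le (S : Setting P f) (G : Good P f y) {C D : ℝ} (hC : 0 ≤ C) (hD : 0 ≤ D)
    (hN : ∀ h m, (nearOptCount P (f m) h (12 * (a.ν * a.ρ ^ h)) : ℝ) ≤ C * (a.ρ ^ h) ^ (-D)) :
    ∑ m, ∑ t ∈ Finset.range a.T, handoverGap P f y m t ≤
      a.M * (11 * a.ν * (2 + layerConst a C)) * (a.T : ℝ) ^ ((D + 1) / (D + 2)) := by
  classical
  have H := S.valid
  have hB := layerConst_nonneg H hC
  have hν := H.ν_pos
  by_cases hex : ∃ m, ∃ t < a.T, ¬ Federated a (layerIdx y m t + 1) ∧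
      (nodeAt y m t).2 ∈ children a (state y (layerIdx y m t)).server
  swap
  · push Not at hex
    have : ∑ m, ∑ t ∈ Finset.range a.T, handoverGap P f y m t = 0 := by
      refine Finset.sum_eq_zero fun m _ => Finset.sum_eq_zero fun t ht => if_neg ?_
      rintro ⟨h1, h2⟩
      exact hex m t (Finset.mem_range.1 ht) h1 h2
    rw [this]
    positivity
  obtain ⟨m₀, t₀, ht₀, hf, hx₀⟩ := hex
  set h := layerIdx y m₀ t₀ with hh
  have hg : ∀ j < h, GlobalAcc P f y j := fun j hj => (G.acc_of_lt S ht₀ hj).1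
  set V := children a (state y h).server with hV
  set n := tau a (h + 1)
  let U : ℕ → ℕ := fun x => if (V.filter (· < x)).card * n < a.T then min a.T n else 0
  have hm : ∀ m, ∑ t ∈ Finset.range a.T, handoverGap P f y m t ≤
      ∑ x ∈ V, U x * gap P f m (h + 1, x) := by
    intro m
    have h1 : ∀ t ∈ Finset.range a.T, handoverGap P f y m t =
        ∑ x ∈ V, if layerIdx y m t = h ∧ (nodeAt y m t).2 = x
          then gap P f m (h + 1, x) else 0 := by
      intro t ht
      by_cases hcond : ¬ Federated a (layerIdx y m t + 1) ∧
        (nodeAt y m t).2 ∈ children a (state y (layerIdx y m t)).server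
      · have e : layerIdx y m t = h := layer_eq_of_handover H hcond.1 hf hcond.2 hx₀
        rw [handoverGap, if_pos hcond]
        have hmem := hcond.2
        rw [e] at hmem
        rw [Finset.sum_eq_single_of_mem _ hmem, if_pos ⟨e, rfl⟩]
        · nth_rw 1 [nodeAt_eq H]
          rw [← e, nodeAt_eq H]
        · intro x _ hx
          exact if_neg fun hc => hx hc.2.symm
      · rw [handoverGap, if_neg hcond]
        refine (Finset.sum_eq_zero fun x hx => if_neg ?_).symm
        rintro ⟨e1, rfl⟩
        exact hcond ⟨by rwa [e1], by rwa [e1]⟩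
    rw [Finset.sum_congr rfl h1, Finset.sum_comm]
    refine Finset.sum_le_sum fun x _ => ?_
    rw [← Finset.sum_filter, Finset.sum_const, nsmul_eq_mul]
    refine mul_le_mul_of_nonneg_right ?_ (gap_nonneg S _ _)
    exact_mod_cast card_nodeAt_eq_le H hf m x
  have hsum : ∑ m, ∑ t ∈ Finset.range a.T, handoverGap P f y m t ≤
      ((∑ x ∈ V, U x : ℕ) : ℝ) * (a.M * (11 * (a.ν * a.ρ ^ h))) := by
    refine (Finset.sum_le_sum fun m _ => hm m).trans ?_
    rw [Finset.sum_comm, Nat.cast_sum, Finset.sum_mul]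
    refine Finset.sum_le_sum fun x hx => ?_
    rw [← Finset.mul_sum]
    exact mul_le_mul_of_nonneg_left (sum_gap_le_of_mem_children_server S hg hx) (by positivity)
  have hU1 : ((∑ x ∈ V, U x : ℕ) : ℝ) ≤ 2 * a.T := by
    exact_mod_cast sum_rank_le (tau_pos H (h + 1)) H.T_pos
  have hU2 : ((∑ x ∈ V, U x : ℕ) : ℝ) ≤ layerConst a C * (a.ρ ^ h) ^ (-(D + 2)) := by
    refine le_trans ?_ (count_mul_tau_le H hC h)
    have h1 : ∑ x ∈ V, U x ≤ V.card * n := by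
      rw [← smul_eq_mul]
      refine Finset.sum_le_card_nsmul _ _ _ fun x _ => ?_
      change ite _ _ _ ≤ _
      split_ifs
      exacts [min_le_right _ _, Nat.zero_le _]
    have h2 : (V.card : ℝ) ≤ a.k * (state y h).server.card := by exact_mod_cast card_children_le _
    have h3 := mul_le_mul_of_nonneg_left (card_server_le S (hN h) hg)
      (by positivity : (0 : ℝ) ≤ a.k)
    have h4 : 0 ≤ a.k * (C * (a.ρ ^ h) ^ (-D)) := by
      have := H.ρ_pos
      positivity
    calc ((∑ x ∈ V, U x : ℕ) : ℝ) ≤ V.card * n := by exact_mod_cast h1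
      _ ≤ _ := mul_le_mul_of_nonneg_right (by linarith) (by positivity)
  have hT1 : (1 : ℝ) ≤ a.T := by exact_mod_cast H.T_pos
  obtain ⟨hu, hu1, hu2⟩ := threshold_spec hT1 hD
  set u := (a.T : ℝ) ^ (-1 / (D + 2))
  set R := (a.T : ℝ) ^ ((D + 1) / (D + 2))
  have hR : 0 ≤ R := by positivity
  have hp : 0 < a.ρ ^ h := pow_pos H.ρ_pos h
  -- The layer is charged by the horizon if its scale is below u, and by its length otherwise.
  have hfin : ((∑ x ∈ V, U x : ℕ) : ℝ) * a.ρ ^ h ≤ (2 + layerConst a C) * R := by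
    rcases le_or_gt (a.ρ ^ h) u with hle | hlt
    · have h1 := mul_le_mul hU1 hle hp.le (by positivity)
      have h2 := mul_nonneg hB hR
      linarith
    · have h1 := mul_le_mul_of_nonneg_right hU2 hp.le
      have h2 := mul_rpow_le_of_lt hu hlt hB hD
      rw [hu2] at h2
      linarith
  refine hsum.trans ?_
  have := mul_le_mul_of_nonneg_left hfin (by positivity : 0 ≤ (a.M : ℝ) * (11 * a.ν))
  linarith

/-- The regret bound on the good event. -/
theorem regret_le_of_good (S : Setting P f) (G : Good P f y) {C D : ℝ} (hC : 0 ≤ C) (hD : 0 ≤ D)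
    (hN : ∀ h m, (nearOptCount P (f m) h (12 * (a.ν * a.ρ ^ h)) : ℝ) ≤ C * (a.ρ ^ h) ^ (-D)) :
    regret P f y ≤ a.M * (a.ν * (35 * (1 + layerConst a C / (1 - a.ρ)) +
      11 * (2 + layerConst a C))) * (a.T : ℝ) ^ ((D + 1) / (D + 2)) := by
  have h1 : regret P f y ≤ ∑ m, ∑ t ∈ Finset.range a.T, 35 * (a.ν * a.ρ ^ layerIdx y m t) +
      ∑ m, ∑ t ∈ Finset.range a.T, handoverGap P f y m t := by
    change ∑ m, ∑ t ∈ Finset.range a.T, gap P f m (nodeAt y m t) ≤ _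
    rw [Finset.sum_comm, Finset.sum_comm (γ := Fin a.M) (f := fun m t => handoverGap P f y m t),
      Finset.sum_comm (γ := Fin a.M) (f := fun m t => 35 * (a.ν * a.ρ ^ layerIdx y m t)),
      ← Finset.sum_add_distrib]
    exact Finset.sum_le_sum fun t ht => sum_gap_nodeAt_le S G (Finset.mem_range.1 ht)
  have h2 : ∀ m, ∑ t ∈ Finset.range a.T, 35 * (a.ν * a.ρ ^ layerIdx y m t) ≤
      35 * a.ν * ((1 + layerConst a C / (1 - a.ρ)) * (a.T : ℝ) ^ ((D + 1) / (D + 2))) := by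
    intro m
    have := mul_le_mul_of_nonneg_left (sum_pow_layerIdx_le S G hC hD hN m)
      (by linarith [S.valid.ν_pos] : 0 ≤ 35 * a.ν)
    rw [Finset.mul_sum] at this
    simpa only [mul_assoc] using this
  have h3 := Finset.sum_le_card_nsmul Finset.univ _ _ fun m _ => h2 m
  rw [Finset.card_univ, Fintype.card_fin, nsmul_eq_mul] at h3
  have h4 := sum_handoverGap_le S G hC hD hN
  linarith

lemma regret_nonneg (S : Setting P f) (y : Rewards a) : 0 ≤ regret P f y :=
  Finset.sum_nonneg fun m _ => Finset.sum_nonneg fun t _ => gap_nonneg S m (nodeAt y m t)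

lemma regret_le (S : Setting P f) (y : Rewards a) : regret P f y ≤ a.M * a.T := by
  have h1 : ∀ m, ∑ t ∈ Finset.range a.T, gap P f m (nodeAt y m t) ≤ a.T := fun m => by
    simpa using Finset.sum_le_card_nsmul (Finset.range a.T) _ 1
      fun t _ => gap_le_one S m (nodeAt y m t)
  have h2 := Finset.sum_le_card_nsmul Finset.univ _ _ fun m _ => h1 m
  rwa [Finset.card_univ, Fintype.card_fin, nsmul_eq_mul] at h2

end PFPNE

/-- All fibres of `g` are measurable; for countable target this is measurability with respect to
the discrete `σ`-algebra. -/
def FiberMeasurable {Ω β : Type*} [MeasurableSpace Ω] (g : Ω → β) : Prop :=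
  ∀ b, MeasurableSet (g ⁻¹' {b})

/-! ### Measurability of the discrete choices of the algorithm -/

namespace FiberMeasurable

variable {Ω β γ δ : Type*} [MeasurableSpace Ω]

lemma const (b : β) : FiberMeasurable fun _ : Ω => b := fun _ => MeasurableSet.const _

/-- Splitting the space by the countably many values of g allows each step of the algorithm to be
treated with the previous state frozen. -/
lemma bind [Countable β] {g : Ω → β} (hg : FiberMeasurable g) {F : β → Ω → γ}
    (hF : ∀ b, FiberMeasurable (F b)) : FiberMeasurable fun ω => F (g ω) ω := by
  intro c
  have : (fun ω => F (g ω) ω) ⁻¹' {c} = ⋃ b, g ⁻¹' {b} ∩ F b ⁻¹' {c} := by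
    ext ω
    simp
  rw [this]
  exact MeasurableSet.iUnion fun b => (hg b).inter (hF b c)

lemma measurable_bind [Countable β] [MeasurableSpace γ] {g : Ω → β} (hg : FiberMeasurable g)
    {F : β → Ω → γ} (hF : ∀ b, Measurable (F b)) : Measurable fun ω => F (g ω) ω := by
  intro s hs
  have : (fun ω => F (g ω) ω) ⁻¹' s = ⋃ b, g ⁻¹' {b} ∩ F b ⁻¹' s := by
    ext ω
    simp
  rw [this]
  exact MeasurableSet.iUnion fun b => (hg b).inter (hF b hs)

lemma map [Countable β] {g : Ω → β} (hg : FiberMeasurable g) (φ : β → γ) :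
    FiberMeasurable fun ω => φ (g ω) := hg.bind fun b => const (φ b)

lemma map₂ [Countable β] [Countable γ] {g : Ω → β} {g' : Ω → γ} (hg : FiberMeasurable g)
    (hg' : FiberMeasurable g') (φ : β → γ → δ) : FiberMeasurable fun ω => φ (g ω) (g' ω) :=
  hg.bind (F := fun b ω => φ b (g' ω)) fun b => hg'.map (φ b)

lemma measurableSet [Countable β] {g : Ω → β} (hg : FiberMeasurable g) (p : β → Prop) :
    MeasurableSet {ω | p (g ω)} := by
  have := hg.map p True
  simpa [Set.preimage] using this

lemma filter {S : Finset β} {p : Ω → β → Prop} [∀ ω, DecidablePred (p ω)] (hp : ∀ i ∈ S, MeasurableSet {ω | p ω i}) :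
    FiberMeasurable fun ω => S.filter (p ω) := by
  classical
  intro A
  by_cases hA : A ⊆ S
  · have : (fun ω => S.filter (p ω)) ⁻¹' {A} =
        ⋂ i ∈ S, if i ∈ A then {ω | p ω i} else {ω | p ω i}ᶜ := by
      ext ω
      simp only [Set.mem_preimage, Set.mem_singleton_iff, Set.mem_iInter]
      constructor
      · rintro h i hi
        split_ifs with hiA
        · rw [← h] at hiA
          exact (Finset.mem_filter.1 hiA).2
        · intro hpi
          exact hiA (h ▸ Finset.mem_filter.2 ⟨hi, hpi⟩)
      · intro h
        ext i
        rw [Finset.mem_filter]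
        constructor
        · rintro ⟨hi, hpi⟩
          by_contra hiA
          have := h i hi
          rw [if_neg hiA] at this
          exact this hpi
        · intro hiA
          have := h i (hA hiA)
          rw [if_pos hiA] at this
          exact ⟨hA hiA, this⟩
    rw [this]
    refine Finset.measurableSet_biInter S fun i hi => ?_
    split_ifs
    exacts [hp i hi, (hp i hi).compl]
  · have : (fun ω => S.filter (p ω)) ⁻¹' {A} = ∅ := by
      ext ω
      simp only [Set.mem_preimage, Set.mem_singleton_iff, Set.mem_empty_iff_false, iff_false]
      rintro rfl
      exact hA (Finset.filter_subset _ _)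
    rw [this]
    exact MeasurableSet.empty

open scoped Classical in
lemma filter_not_lt {S : Finset β} {u : Ω → β → ℝ} {w : Ω → ℝ}
    (hu : ∀ i, Measurable fun ω => u ω i) (hw : Measurable w) :
    FiberMeasurable fun ω => S.filter fun i => ¬ (u ω i < w ω) := by
  refine FiberMeasurable.filter (p := fun ω i => ¬ (u ω i < w ω)) fun i _ => ?_
  have : {ω | ¬ (u ω i < w ω)} = {ω | w ω ≤ u ω i} := by
    ext ω
    simp
  rw [this]
  exact measurableSet_le hw (hu i)

end FiberMeasurable

namespace PFPNE

variable {a : Params} {Ω : Type*} [MeasurableSpace Ω]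

instance : Countable (State a) :=
  Function.Injective.countable (f := fun s : State a => (s.server, s.client)) (by
    rintro ⟨_, _⟩ ⟨_, _⟩ h
    simpa using h)

lemma fiberMeasurable_argmax (S : Finset ℕ) {g : Ω → ℕ → ℝ}
    (hg : ∀ i, Measurable fun ω => g ω i) : FiberMeasurable fun ω => argmax S (g ω) := by
  classical
  have e : (fun ω => argmax S (g ω)) = fun ω =>
      sInf ((S.filter fun i => ∀ j ∈ S, g ω j ≤ g ω i : Finset ℕ) : Set ℕ) := by
    funext ω
    simp [argmax]
  rw [e]
  refine FiberMeasurable.map (g := fun ω => S.filter fun i => ∀ j ∈ S, g ω j ≤ g ω i) ?_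
    fun A : Finset ℕ => sInf (A : Set ℕ)
  have hm : ∀ i ∈ S, MeasurableSet {ω | ∀ j ∈ S, g ω j ≤ g ω i} := by
    intro i _
    have : {ω | ∀ j ∈ S, g ω j ≤ g ω i} = ⋂ j ∈ S, {ω | g ω j ≤ g ω i} := by
      ext ω
      simp
    rw [this]
    exact Finset.measurableSet_biInter S fun j _ => measurableSet_le (hg j) (hg i)
  convert! FiberMeasurable.filter (S := S) (p := fun ω i => ∀ j ∈ S, g ω j ≤ g ω i) hm

section

variable {Y : Ω → Rewards a} {h : ℕ} (hY : ∀ m i n, Measurable fun ω => Y ω m h i n)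
include hY

lemma measurable_globalMean (i : ℕ) : Measurable fun ω => globalMean a (Y ω) h i :=
  (Finset.measurable_sum _ fun m _ => Finset.measurable_sum _ fun n _ => hY m i n).div_const _

lemma measurable_localMean (m : Fin a.M) (i : ℕ) : Measurable fun ω => localMean a (Y ω) m h i :=
  (Finset.measurable_sum _ fun n _ => hY m i n).div_const _

lemma fiberMeasurable_serverKeep (s : State a) :
    FiberMeasurable fun ω => serverKeep (Y ω) s h := by
  refine FiberMeasurable.filter_not_lt (fun i => ?_) ?_
  · exact ((measurable_globalMean hY i).add_const _).add_const _
  · exact (FiberMeasurable.measurable_bind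
      (fiberMeasurable_argmax _ fun i => measurable_globalMean hY i)
      (F := fun j ω => globalMean a (Y ω) h j) fun j => measurable_globalMean hY j).sub_const _

lemma measurable_clientMean (s : State a) (m : Fin a.M) (i : ℕ) :
    Measurable fun ω => clientMean (Y ω) s m h i := by
  classical
  refine (fiberMeasurable_serverKeep hY s).measurable_bind
    (F := fun K ω => if i ∈ K then globalMean a (Y ω) h i else localMean a (Y ω) m h i) fun K => ?_
  split_ifs
  exacts [measurable_globalMean hY i, measurable_localMean hY m i]

lemma measurable_clientWidth (s : State a) (i : ℕ) :
    Measurable fun ω => clientWidth (Y ω) s h i := by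
  classical
  exact (fiberMeasurable_serverKeep hY s).measurable_bind
    (F := fun K _ => if i ∈ K then globalWidth a h else localWidth a h) fun K => measurable_const

lemma fiberMeasurable_clientBest (s : State a) (m : Fin a.M) :
    FiberMeasurable fun ω => clientBest (Y ω) s m h :=
  fiberMeasurable_argmax _ fun i => measurable_clientMean hY s m i

lemma fiberMeasurable_clientKeep (s : State a) (m : Fin a.M) :
    FiberMeasurable fun ω => clientKeep (Y ω) s m h := by
  classical
  refine (fiberMeasurable_serverKeep hY s).bind
    (F := fun K ω => (clientCand s m \ K).filter fun i =>
      ¬ (clientMean (Y ω) s m h i + clientWidth (Y ω) s h i + a.ν * a.ρ ^ h <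
        clientMean (Y ω) s m h (clientBest (Y ω) s m h) -
          clientWidth (Y ω) s h (clientBest (Y ω) s m h))) fun K => ?_
  refine FiberMeasurable.filter_not_lt (fun i => ?_) ?_
  · exact ((measurable_clientMean hY s m i).add (measurable_clientWidth hY s i)).add_const _
  · exact (fiberMeasurable_clientBest hY s m).measurable_bind
      (F := fun j ω => clientMean (Y ω) s m h j - clientWidth (Y ω) s h j) fun j =>
        (measurable_clientMean hY s m j).sub (measurable_clientWidth hY s j)

/-- For a fixed state, the rewards influence the pulls only through the server's elimination and the
client's best node. -/
lemma fiberMeasurable_layerPulls (s : State a) (m : Fin a.M) :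
    FiberMeasurable fun ω => layerPulls (Y ω) s m h :=
  (fiberMeasurable_serverKeep hY s).map₂ (fiberMeasurable_clientBest hY s m) fun K b =>
    blocks (serverCand s h) (share a h) ++ blocks (serverCand s h \ K) (tau a h - share a h) ++
      ownPulls s m h ++ List.replicate (waitingTime s m h) b

end

/-- The state after the layers `1, …, h` is determined by the rewards of these layers. -/
lemma fiberMeasurable_state {Y : Ω → Rewards a} {h : ℕ}
    (hY : ∀ m, ∀ j ≤ h, ∀ i n, Measurable fun ω => Y ω m j i n) :
    FiberMeasurable fun ω => state (Y ω) h := by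
  induction h with
  | zero => exact FiberMeasurable.const _
  | succ h ih =>
    refine (ih fun m j hj => hY m j (by omega)).bind
      (F := fun s ω => (⟨serverKeep (Y ω) s (h + 1), fun m => clientKeep (Y ω) s m (h + 1)⟩ : State a))
      fun s => ?_
    intro b
    have hY' : ∀ m i n, Measurable fun ω => Y ω m (h + 1) i n := fun m => hY m (h + 1) le_rfl
    have : (fun ω => (⟨serverKeep (Y ω) s (h + 1), fun m => clientKeep (Y ω) s m (h + 1)⟩ :
        State a)) ⁻¹' {b} = (fun ω => serverKeep (Y ω) s (h + 1)) ⁻¹' {b.server} ∩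
          ⋂ m, (fun ω => clientKeep (Y ω) s m (h + 1)) ⁻¹' {b.client m} := by
      obtain ⟨b₁, b₂⟩ := b
      ext ω
      simp [funext_iff]
    rw [this]
    exact (fiberMeasurable_serverKeep hY' s _).inter
      (MeasurableSet.iInter fun m => fiberMeasurable_clientKeep hY' s m _)

variable {Y : Ω → Rewards a} (hY : ∀ m h i n, Measurable fun ω => Y ω m h i n)
include hY

lemma fiberMeasurable_pulls (m : Fin a.M) (N : ℕ) : FiberMeasurable fun ω => pulls (Y ω) m N := by
  induction N with
  | zero => exact FiberMeasurable.const _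
  | succ N ih =>
    simp only [pulls_succ]
    refine ih.map₂ (g' := fun ω => layerPulls (Y ω) (state (Y ω) N) m (N + 1)) ?_ fun l l' =>
      l ++ l'.map fun i => (N + 1, i)
    exact (fiberMeasurable_state fun m j _ => hY m j).bind
      (F := fun s ω => layerPulls (Y ω) s m (N + 1)) fun s =>
        fiberMeasurable_layerPulls (fun m => hY m (N + 1)) s m

lemma measurable_regret {X : Type*} (P : HierarchicalPartition X a.k) (f : Fin a.M → X → ℝ) :
    Measurable fun ω => regret P f (Y ω) :=
  Finset.measurable_sum _ fun m _ => Finset.measurable_sum _ fun t _ =>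
    (fiberMeasurable_pulls hY m (t + 1)).measurable_bind (F := fun l _ =>
      XArmed.optValue (f m) - f m (P.rep (l.getD t (0, 0)).1 (l.getD t (0, 0)).2))
      fun _ => measurable_const

end PFPNE

/-! ### Concentration -/

/-- Hoeffding's inequality for the two-sided deviation of a sum of independent variables in
`[0, 1]`. -/
lemma measure_abs_sum_sub_ge_le {Ω ι : Type*} [MeasurableSpace Ω] {μ : Measure Ω}
    [IsProbabilityMeasure μ] {X : ι → Ω → ℝ} (hX : ∀ i, Measurable (X i))
    (h01 : ∀ i, ∀ᵐ ω ∂μ, X i ω ∈ Set.Icc (0 : ℝ) 1) (hind : iIndepFun X μ) (s : Finset ι)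
    {ε : ℝ} (hε : 0 ≤ ε) :
    μ.real {ω | s.card * ε ≤ |∑ i ∈ s, (X i ω - ∫ ω, X i ω ∂μ)|} ≤
      2 * Real.exp (-2 * s.card * ε ^ 2) := by
  have hsub : ∀ i, HasSubgaussianMGF (fun ω => X i ω - ∫ ω, X i ω ∂μ) ((‖(1 : ℝ) - 0‖₊ / 2) ^ 2) μ :=
    fun i => hasSubgaussianMGF_of_mem_Icc (hX i).aemeasurable (h01 i)
  have hind₁ : iIndepFun (fun i ω => X i ω - ∫ ω, X i ω ∂μ) μ :=
    hind.comp (fun i x => x - ∫ ω, X i ω ∂μ) fun i => measurable_id.sub_const _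
  have hind₂ : iIndepFun (fun i ω => -(X i ω - ∫ ω, X i ω ∂μ)) μ :=
    hind.comp (fun i x => -(x - ∫ ω, X i ω ∂μ)) fun i => (measurable_id.sub_const _).neg
  have hε' : 0 ≤ s.card * ε := by positivity
  have h₁ := HasSubgaussianMGF.measure_sum_ge_le_of_iIndepFun hind₁ (s := s)
    (c := fun _ => (‖(1 : ℝ) - 0‖₊ / 2) ^ 2) (fun i _ => hsub i) hε'
  have h₂ := HasSubgaussianMGF.measure_sum_ge_le_of_iIndepFun hind₂ (s := s)
    (c := fun _ => (‖(1 : ℝ) - 0‖₊ / 2) ^ 2) (fun i _ => (hsub i).neg) hε'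
  -- Each variable has sub-Gaussian parameter 1/4. For empty s the denominator vanishes and both
  -- sides are 0.
  have e : -(s.card * ε) ^ 2 / (2 * ((∑ _i ∈ s, (‖(1 : ℝ) - 0‖₊ / 2) ^ 2 : NNReal) : ℝ)) =
      -2 * s.card * ε ^ 2 := by
    rcases s.eq_empty_or_nonempty with rfl | hs
    · simp
    · have : (s.card : ℝ) ≠ 0 := by exact_mod_cast hs.card_pos.ne'
      simp only [Finset.sum_const, nsmul_eq_mul]
      push_cast
      simp only [sub_zero, norm_one]
      field_simp
  rw [e] at h₁ h₂
  calc μ.real {ω | s.card * ε ≤ |∑ i ∈ s, (X i ω - ∫ ω, X i ω ∂μ)|}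
      ≤ μ.real ({ω | s.card * ε ≤ ∑ i ∈ s, (X i ω - ∫ ω, X i ω ∂μ)} ∪
          {ω | s.card * ε ≤ ∑ i ∈ s, -(X i ω - ∫ ω, X i ω ∂μ)}) := by
        refine measureReal_mono ?_
        intro ω hω
        have hω : s.card * ε ≤ |∑ i ∈ s, (X i ω - ∫ ω, X i ω ∂μ)| := hω
        rcases le_abs.1 hω with h | h
        · exact Or.inl h
        · right
          change s.card * ε ≤ ∑ i ∈ s, -(X i ω - ∫ ω, X i ω ∂μ)
          rwa [Finset.sum_neg_distrib]
    _ ≤ _ := measureReal_union_le _ _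
    _ ≤ 2 * Real.exp (-2 * s.card * ε ^ 2) := by linarith

/-- The deviation of an average of `n` variables beyond `5 / 8` of a confidence width of the form
`c * √(L / n)` with `2 ≤ c`. -/
lemma measure_abs_avg_sub_gt_le {Ω ι : Type*} [MeasurableSpace Ω] {μ : Measure Ω}
    [IsProbabilityMeasure μ] {X : ι → Ω → ℝ} (hX : ∀ i, Measurable (X i))
    (h01 : ∀ i, ∀ᵐ ω ∂μ, X i ω ∈ Set.Icc (0 : ℝ) 1) (hind : iIndepFun X μ) {s : Finset ι}
    {n c L b : ℝ} (hs : (s.card : ℝ) = n) (hn : 0 < n) (hc : 2 ≤ c) (hL : 0 ≤ L)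
    (hb : (∑ i ∈ s, ∫ ω, X i ω ∂μ) = n * b) :
    μ {ω | 5 / 8 * (c * √(L / n)) < |(∑ i ∈ s, X i ω) / n - b|} ≤
      ENNReal.ofReal (2 * Real.exp (-(3 * L))) := by
  rw [← ofReal_measureReal]
  refine ENNReal.ofReal_le_ofReal ?_
  have hε : 0 ≤ 5 / 8 * (c * √(L / n)) := by positivity
  refine le_trans (measureReal_mono ?_) ((measure_abs_sum_sub_ge_le hX h01 hind s hε).trans ?_)
  · intro ω hω
    have hω : 5 / 8 * (c * √(L / n)) < |(∑ i ∈ s, X i ω) / n - b| := hω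
    change (s.card : ℝ) * (5 / 8 * (c * √(L / n))) ≤ |∑ i ∈ s, (X i ω - ∫ ω, X i ω ∂μ)|
    rw [Finset.sum_sub_distrib, hb, hs]
    have e : (∑ i ∈ s, X i ω) - n * b = n * ((∑ i ∈ s, X i ω) / n - b) := by field_simp
    rw [e, abs_mul, abs_of_pos hn]
    exact mul_le_mul_of_nonneg_left hω.le hn.le
  · refine mul_le_mul_of_nonneg_left (Real.exp_le_exp.2 ?_) zero_le_two
    rw [hs, mul_pow, mul_pow, Real.sq_sqrt (by positivity)]
    have e : -2 * n * ((5 / 8) ^ 2 * (c ^ 2 * (L / n))) = -(25 / 32 * c ^ 2 * L) := by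
      field_simp
      ring
    rw [e]
    -- The exponent is at least 25/32 · 4 = 25/8 times L, which exceeds 3 L; this dictates how small
    -- a fraction of the width can be afforded as error.
    have : 4 ≤ c ^ 2 := by nlinarith
    nlinarith

/-- A union bound over a random set of indices that is independent of the events. -/
lemma measure_exists_mem_le {Ω : Type*} {m₁ m₂ m₀ : MeasurableSpace Ω} {μ : Measure Ω}
    [IsProbabilityMeasure μ] (h₁ : m₁ ≤ m₀) (hind : Indep m₁ m₂ μ) {K : Ω → Finset ℕ}
    (hK : @FiberMeasurable Ω _ m₁ K) {N T : ℕ} (hN : ∀ ω, ∀ i ∈ K ω, i < N) {B : ℕ → Set Ω}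
    {q : ENNReal} (hB : ∀ i < N, MeasurableSet[m₂] (B i)) (hq : ∀ i < N, μ (B i) ≤ q) :
    μ {ω | (K ω).card ≤ T ∧ ∃ i ∈ K ω, ω ∈ B i} ≤ T * q := by
  classical
  let A : ℕ → Set Ω := fun i => {ω | i ∈ K ω ∧ (K ω).card ≤ T}
  have hA : ∀ i, MeasurableSet[m₁] (A i) := fun i =>
    @FiberMeasurable.measurableSet Ω _ m₁ _ K hK fun S => i ∈ S ∧ S.card ≤ T
  calc μ {ω | (K ω).card ≤ T ∧ ∃ i ∈ K ω, ω ∈ B i}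
      ≤ μ (⋃ i ∈ Finset.range N, A i ∩ B i) := by
        refine measure_mono ?_
        rintro ω ⟨hT, i, hi, hωB⟩
        simp only [Set.mem_iUnion, Finset.mem_range]
        exact ⟨i, hN ω i hi, ⟨hi, hT⟩, hωB⟩
    _ ≤ ∑ i ∈ Finset.range N, μ (A i ∩ B i) := measure_biUnion_finset_le _ _
    _ ≤ ∑ i ∈ Finset.range N, μ (A i) * q := by
        refine Finset.sum_le_sum fun i hi => ?_
        have hi := Finset.mem_range.1 hi
        rw [(Indep_iff m₁ m₂ μ).1 hind _ _ (hA i) (hB i hi)]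
        gcongr
        exact hq i hi
    _ = (∑ i ∈ Finset.range N, μ (A i)) * q := by rw [Finset.sum_mul]
    _ ≤ T * q := by
        gcongr
        -- The sum is the expected size of K on the event that this size is at most T, so the number
        -- N of possible indices drops out.
        calc ∑ i ∈ Finset.range N, μ (A i)
            = ∫⁻ ω, ∑ i ∈ Finset.range N, (A i).indicator 1 ω ∂μ := by
              rw [lintegral_finsetSum _ fun i _ => measurable_one.indicator (h₁ _ (hA i))]
              refine Finset.sum_congr rfl fun i _ => ?_
              rw [lintegral_indicator_one (h₁ _ (hA i))]
          _ ≤ ∫⁻ _, (T : ENNReal) ∂μ := by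
              refine lintegral_mono fun ω => ?_
              by_cases hT : (K ω).card ≤ T
              · have e : ∀ i, (A i).indicator (1 : Ω → ENNReal) ω = if i ∈ K ω then 1 else 0 := by
                  intro i
                  simp [Set.indicator, A, hT]
                simp only [e, Finset.sum_boole]
                have : ((Finset.range N).filter fun i => i ∈ K ω).card ≤ T :=
                  (Finset.card_le_card fun i hi => (Finset.mem_filter.1 hi).2).trans hT
                exact_mod_cast this
              · have e : ∀ i, (A i).indicator (1 : Ω → ENNReal) ω = 0 := by
                  intro i
                  simp [Set.indicator, A, hT]
                simp [e]
          _ = T := by simp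

lemma measurableSet_lt_abs_sub {Ω : Type*} {m : MeasurableSpace Ω} {u : Ω → ℝ} (hu : Measurable u)
    (w b : ℝ) : MeasurableSet {ω | w < |u ω - b|} :=
  measurableSet_lt measurable_const (hu.sub_const b).norm

/-! ### Probability of the good event and expected regret -/

namespace PFPNE

open XArmed

variable {a : Params} {X : Type*} {P : HierarchicalPartition X a.k} {f : Fin a.M → X → ℝ}
  {Ω : Type*} [mΩ : MeasurableSpace Ω] {μ : Measure Ω} [IsProbabilityMeasure μ]
  {Y : Fin a.M → ℕ → ℕ → ℕ → Ω → ℝ}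

/-- The realization of the rewards at `ω`. -/
def rewards (Y : Fin a.M → ℕ → ℕ → ℕ → Ω → ℝ) (ω : Ω) : Rewards a := fun m h i n => Y m h i n ω

/-- A bound on the probability that a single estimate is inaccurate. -/
def failProb (a : Params) : ENNReal := ENNReal.ofReal (2 * Real.exp (-(3 * logTerm a)))

lemma measure_localMean_le (H : a.Valid) (hY : IsRewardTable P f μ Y) (m : Fin a.M) {h i : ℕ}
    (hi : i < a.k ^ h) :
    μ {ω | 5 / 8 * localWidth a h < |localMean a (rewards Y ω) m h i - f m (P.rep h i)|} ≤
      failProb a := by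
  have hinj : Function.Injective fun n : ℕ => ((m, h, i, n) : Fin a.M × ℕ × ℕ × ℕ) :=
    fun n n' e => by simpa using e
  refine measure_abs_avg_sub_gt_le (X := fun n => Y m h i n) (fun n => hY.measurable m h i n)
    (fun n => hY.mem_Icc m h i n) (hY.indep.precomp (g := fun n : ℕ => (m, h, i, n)) hinj)
    (s := Finset.range (tau a h))
    (n := tau a h) (by simp) (by exact_mod_cast tau_pos H h) H.two_le_c H.logTerm_pos.le ?_
  simp [hY.mean m h i _ hi]

lemma measure_globalMean_le (H : a.Valid) (hY : IsRewardTable P f μ Y) {h i : ℕ}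
    (hi : i < a.k ^ h) :
    μ {ω | 5 / 8 * globalWidth a h <
      |globalMean a (rewards Y ω) h i - avgObjective f (P.rep h i)|} ≤ failProb a := by
  have hinj : Function.Injective fun q : Fin a.M × ℕ => ((q.1, h, i, q.2) : Fin a.M × ℕ × ℕ × ℕ) := by
    rintro ⟨m, n⟩ ⟨m', n'⟩ e
    simpa using e
  have hM : (a.M : ℝ) ≠ 0 := by exact_mod_cast H.M_pos.ne'
  have := measure_abs_avg_sub_gt_le (μ := μ) (X := fun q : Fin a.M × ℕ => Y q.1 h i q.2)
    (fun q => hY.measurable _ h i _) (fun q => hY.mem_Icc _ h i _) (hY.indep.precomp (g := fun q : Fin a.M × ℕ => (q.1, h, i, q.2)) hinj)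
    (s := Finset.univ ×ˢ Finset.range (share a h)) (n := a.M * share a h)
    (b := avgObjective f (P.rep h i)) (by simp)
    (by exact_mod_cast Nat.mul_pos H.M_pos (share_pos H h)) H.two_le_c H.logTerm_pos.le (by
      rw [Finset.sum_product]
      simp only [hY.mean _ h i _ hi, Finset.sum_const, Finset.card_range, nsmul_eq_mul,
        avgObjective, ← Finset.mul_sum]
      field_simp)
  simp only [Finset.sum_product] at this
  exact this

/-- The `σ`-algebra of the rewards of the nodes whose depth is in `S`. -/
@[reducible]
def depthAlgebra (Y : Fin a.M → ℕ → ℕ → ℕ → Ω → ℝ) (S : Set ℕ) : MeasurableSpace Ω :=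
  ⨆ q ∈ {q : Fin a.M × ℕ × ℕ × ℕ | q.2.1 ∈ S},
    MeasurableSpace.comap (Y q.1 q.2.1 q.2.2.1 q.2.2.2) inferInstance

omit [IsProbabilityMeasure μ] in
lemma indep_depthAlgebra (hY : IsRewardTable P f μ Y) {S S' : Set ℕ} (h : Disjoint S S') :
    Indep (depthAlgebra Y S) (depthAlgebra Y S') μ := by
  refine indep_iSup_of_disjoint (fun q => (hY.measurable _ _ _ _).comap_le) hY.indep.iIndep ?_
  exact h.preimage fun q : Fin a.M × ℕ × ℕ × ℕ => q.2.1

omit [IsProbabilityMeasure μ] in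
lemma depthAlgebra_le (hY : IsRewardTable P f μ Y) (S : Set ℕ) : depthAlgebra Y S ≤ mΩ :=
  iSup₂_le fun _ _ => (hY.measurable _ _ _ _).comap_le

omit mΩ in
lemma measurable_depthAlgebra (Y : Fin a.M → ℕ → ℕ → ℕ → Ω → ℝ) {S : Set ℕ} {h : ℕ} (hh : h ∈ S)
    (m : Fin a.M) (i n : ℕ) : Measurable[depthAlgebra Y S] (Y m h i n) := by
  refine (comap_measurable (Y m h i n)).mono ?_ le_rfl
  exact le_iSup₂_of_le (m, h, i, n) hh le_rfl

omit mΩ in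
lemma fiberMeasurable_state_depthAlgebra (Y : Fin a.M → ℕ → ℕ → ℕ → Ω → ℝ) (h : ℕ) :
    @FiberMeasurable Ω _ (depthAlgebra Y (Set.Iic h)) fun ω => state (rewards Y ω) h :=
  @fiberMeasurable_state a Ω (depthAlgebra Y (Set.Iic h)) (rewards Y) h
    fun m _ hj i n => measurable_depthAlgebra Y (Set.mem_Iic.2 hj) m i n

/-- The candidates of layer h + 1 are determined by rewards of depth at most h and their estimates
by rewards of depth h + 1. This independence replaces a union bound over all k ^ (h + 1) nodes by
one over at most T candidates. -/
lemma measure_not_localAcc_le (H : a.Valid) (hY : IsRewardTable P f μ Y) (m : Fin a.M) (h : ℕ) :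
    μ {ω | (clientCand (state (rewards Y ω) h) m).card ≤ a.T ∧
      ¬ LocalAcc P f (rewards Y ω) m h} ≤ a.T * failProb a := by
  have hd : Disjoint (Set.Iic h) {h + 1} := by simp
  refine (measure_mono ?_).trans (measure_exists_mem_le (depthAlgebra_le hY _)
    (indep_depthAlgebra hY hd)
    (@FiberMeasurable.map Ω _ _ (depthAlgebra Y (Set.Iic h)) _ _
      (fiberMeasurable_state_depthAlgebra Y h) fun s => clientCand s m)
    (fun ω i hi => lt_of_mem_clientCand hi)
    (B := fun i => {ω | 5 / 8 * localWidth a (h + 1) <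
      |localMean a (rewards Y ω) m (h + 1) i - f m (P.rep (h + 1) i)|})
    (fun i _ => ?_) fun i hi => measure_localMean_le H hY m hi)
  · rintro ω ⟨h1, h2⟩
    refine ⟨h1, ?_⟩
    unfold LocalAcc at h2
    push Not at h2
    exact h2
  · have hm := @measurable_localMean a Ω (depthAlgebra Y {h + 1}) (rewards Y) (h + 1)
      (fun m i n => measurable_depthAlgebra Y (Set.mem_singleton _) m i n) m i
    exact measurableSet_lt_abs_sub hm _ _

lemma measure_not_globalAcc_le (H : a.Valid) (hY : IsRewardTable P f μ Y) (h : ℕ) :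
    μ {ω | (serverCand (state (rewards Y ω) h) (h + 1)).card ≤ a.T ∧
      ¬ GlobalAcc P f (rewards Y ω) h} ≤ a.T * failProb a := by
  have hd : Disjoint (Set.Iic h) {h + 1} := by simp
  refine (measure_mono ?_).trans (measure_exists_mem_le (depthAlgebra_le hY _)
    (indep_depthAlgebra hY hd)
    (@FiberMeasurable.map Ω _ _ (depthAlgebra Y (Set.Iic h)) _ _
      (fiberMeasurable_state_depthAlgebra Y h) fun s => serverCand s (h + 1))
    (fun ω i hi => lt_of_mem_clientCand
      (serverCand_subset_clientCand _ ⟨0, H.M_pos⟩ (h + 1) hi))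
    (B := fun i => {ω | 5 / 8 * globalWidth a (h + 1) <
      |globalMean a (rewards Y ω) (h + 1) i - avgObjective f (P.rep (h + 1) i)|})
    (fun i _ => ?_) fun i hi => measure_globalMean_le H hY hi)
  · rintro ω ⟨h1, h2⟩
    refine ⟨h1, ?_⟩
    unfold GlobalAcc at h2
    push Not at h2
    exact h2
  · have hm := @measurable_globalMean a Ω (depthAlgebra Y {h + 1}) (rewards Y) (h + 1)
      (fun m i n => measurable_depthAlgebra Y (Set.mem_singleton _) m i n) i
    exact measurableSet_lt_abs_sub hm _ _

/-- The good event fails with small probability. -/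
lemma measure_not_good_le (H : a.Valid) (hY : IsRewardTable P f μ Y) :
    μ {ω | ¬ Good P f (rewards Y ω)} ≤ a.T * (a.T * failProb a + a.M * (a.T * failProb a)) := by
  have hsub : {ω | ¬ Good P f (rewards Y ω)} ⊆ ⋃ h ∈ Finset.range a.T,
      ({ω | (serverCand (state (rewards Y ω) h) (h + 1)).card ≤ a.T ∧
        ¬ GlobalAcc P f (rewards Y ω) h} ∪
      ⋃ m ∈ Finset.univ, {ω | (clientCand (state (rewards Y ω) h) m).card ≤ a.T ∧
        ¬ LocalAcc P f (rewards Y ω) m h}) := by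
    intro ω hω
    by_contra hcon
    refine hω fun h hh => ⟨fun hc => ?_, fun m hc => ?_⟩
    · by_contra hg
      exact hcon (Set.mem_biUnion (x := h) (by simpa using hh) (Or.inl ⟨hc, hg⟩))
    · by_contra hg
      exact hcon (Set.mem_biUnion (x := h) (by simpa using hh)
        (Or.inr (Set.mem_biUnion (x := m) (by simp) ⟨hc, hg⟩)))
  refine (measure_mono hsub).trans ((measure_biUnion_finset_le _ _).trans ?_)
  refine (Finset.sum_le_card_nsmul _ _ (a.T * failProb a + a.M * (a.T * failProb a))
    fun h _ => ?_).trans_eq (by rw [Finset.card_range, nsmul_eq_mul])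
  refine (measure_union_le _ _).trans (add_le_add (measure_not_globalAcc_le H hY h) ?_)
  refine (measure_biUnion_finset_le _ _).trans ?_
  refine (Finset.sum_le_card_nsmul _ _ _ fun m _ => measure_not_localAcc_le H hY m h).trans ?_
  simp

/-- The bound on the expected regret, in terms of the inputs of the algorithm. -/
theorem integral_regret_le (S : Setting P f) (hY : IsRewardTable P f μ Y) {C D : ℝ} (hC : 0 ≤ C)
    (hD : 0 ≤ D)
    (hN : ∀ h m, (nearOptCount P (f m) h (12 * (a.ν * a.ρ ^ h)) : ℝ) ≤ C * (a.ρ ^ h) ^ (-D))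
    (hexp : Real.exp (-(3 * logTerm a)) ≤ ((a.M * a.T : ℝ) ^ 3)⁻¹) :
    Integrable (fun ω => regret P f (rewards Y ω)) μ ∧
      ∫ ω, regret P f (rewards Y ω) ∂μ ≤
        a.M * (a.ν * (35 * (1 + layerConst a C / (1 - a.ρ)) + 11 * (2 + layerConst a C))) *
          (a.T : ℝ) ^ ((D + 1) / (D + 2)) + 4 := by
  have H := S.valid
  set B := a.M * (a.ν * (35 * (1 + layerConst a C / (1 - a.ρ)) + 11 * (2 + layerConst a C))) *
    (a.T : ℝ) ^ ((D + 1) / (D + 2)) with hBdef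
  have hB : 0 ≤ B := by
    have h1 := layerConst_nonneg H hC
    have h2 : 0 ≤ layerConst a C / (1 - a.ρ) := div_nonneg h1 (by linarith [H.ρ_lt_one])
    have := H.ν_pos
    positivity
  have hmeas : Measurable fun ω => regret P f (rewards Y ω) :=
    measurable_regret (Y := rewards Y) (fun m h i n => hY.measurable m h i n) P f
  have hint : Integrable (fun ω => regret P f (rewards Y ω)) μ := by
    refine Integrable.of_mem_Icc 0 (a.M * a.T) hmeas.aemeasurable (ae_of_all _ fun ω => ?_)
    exact ⟨regret_nonneg S _, regret_le S _⟩
  refine ⟨hint, ?_⟩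
  -- A measurable hull of the same measure makes measurability of the good event unnecessary.
  set N := toMeasurable μ {ω | ¬ Good P f (rewards Y ω)} with hNdef
  have hNm : MeasurableSet N := measurableSet_toMeasurable _ _
  have hMT : (0 : ℝ) ≤ a.M * a.T := by positivity
  have hM1 : (1 : ℝ) ≤ a.M := by exact_mod_cast H.M_pos
  have hT1 : (1 : ℝ) ≤ a.T := by exact_mod_cast H.T_pos
  have hle : ∀ ω, regret P f (rewards Y ω) ≤ B + N.indicator (fun _ => (a.M * a.T : ℝ)) ω := by
    intro ω
    by_cases hG : Good P f (rewards Y ω)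
    · have h1 := regret_le_of_good S hG hC hD hN
      have h2 : 0 ≤ N.indicator (fun _ => (a.M * a.T : ℝ)) ω := Set.indicator_nonneg (fun _ _ => hMT) _
      linarith
    · rw [Set.indicator_of_mem (subset_toMeasurable _ _ hG)]
      linarith [regret_le S (rewards Y ω)]
  have hind : Integrable (N.indicator fun _ => (a.M * a.T : ℝ)) μ :=
    (integrable_const _).indicator hNm
  have hNreal : μ.real N ≤ 4 * a.M * a.T ^ 2 * ((a.M * a.T : ℝ) ^ 3)⁻¹ := by
    have hp : (0 : ℝ) ≤ 2 * Real.exp (-(3 * logTerm a)) := by positivity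
    have h1 : μ N ≤ ENNReal.ofReal (a.T * (a.T * (2 * Real.exp (-(3 * logTerm a))) +
        a.M * (a.T * (2 * Real.exp (-(3 * logTerm a)))))) := by
      rw [hNdef, measure_toMeasurable]
      refine (measure_not_good_le H hY).trans_eq ?_
      unfold failProb
      generalize 2 * Real.exp (-(3 * logTerm a)) = p at hp
      rw [ENNReal.ofReal_mul (by positivity), ENNReal.ofReal_add (by positivity) (by positivity),
        ENNReal.ofReal_mul (p := (a.M : ℝ)) (by positivity),
        ENNReal.ofReal_mul (p := (a.T : ℝ)) (by positivity), ENNReal.ofReal_natCast,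
        ENNReal.ofReal_natCast]
    refine (ENNReal.toReal_le_of_le_ofReal (by positivity) h1).trans ?_
    have h2 : (a.T : ℝ) * (a.T * (2 * Real.exp (-(3 * logTerm a))) +
        a.M * (a.T * (2 * Real.exp (-(3 * logTerm a))))) =
        2 * (1 + a.M) * a.T ^ 2 * Real.exp (-(3 * logTerm a)) := by ring
    rw [h2]
    refine mul_le_mul ?_ hexp (Real.exp_pos _).le (by positivity)
    exact mul_le_mul_of_nonneg_right (by linarith) (by positivity)
  calc ∫ ω, regret P f (rewards Y ω) ∂μ
      ≤ ∫ ω, (B + N.indicator (fun _ => (a.M * a.T : ℝ)) ω) ∂μ :=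
        integral_mono hint ((integrable_const _).add hind) hle
    _ = B + μ.real N * (a.M * a.T) := by
        rw [integral_add (integrable_const _) hind, integral_indicator_const _ hNm]
        simp
    _ ≤ B + 4 := by
        have h1 := mul_le_mul_of_nonneg_right hNreal hMT
        -- Failure probability times the trivial regret bound M T.
        have h2 : 4 * (a.M : ℝ) * a.T ^ 2 * ((a.M * a.T : ℝ) ^ 3)⁻¹ * (a.M * a.T) = 4 / a.M := by
          field_simp
        have h3 : 4 / (a.M : ℝ) ≤ 4 := div_le_self (by norm_num) hM1
        linarith

end PFPNE

/-! ### Constants and conclusion -/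

namespace PFPNE

/-- Separates the logarithm from the part that depends only on k, ν, ρ, C, c; z ≥ 1 absorbs the
rounding term. -/
lemma layerConst_le {a : Params} {C x z : ℝ} (hC : 0 ≤ C) (hx : logTerm a ≤ z)
    (hz : 1 ≤ z) (h : x = 3 * a.k * C * ((a.c ^ 2 / a.ν ^ 2 + 1) / a.ρ ^ 2)) :
    layerConst a C ≤ x * z := by
  have h1 : a.c ^ 2 * logTerm a / a.ν ^ 2 + 1 ≤ (a.c ^ 2 / a.ν ^ 2 + 1) * z := by
    have := mul_le_mul_of_nonneg_left hx (by positivity : 0 ≤ a.c ^ 2 / a.ν ^ 2)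
    have e : a.c ^ 2 * logTerm a / a.ν ^ 2 = a.c ^ 2 / a.ν ^ 2 * logTerm a := by ring
    linarith
  have h2 := mul_le_mul_of_nonneg_left h1 (by positivity : 0 ≤ 3 * a.k * C * (a.ρ ^ 2)⁻¹)
  calc layerConst a C
      = 3 * a.k * C * (a.ρ ^ 2)⁻¹ * (a.c ^ 2 * logTerm a / a.ν ^ 2 + 1) := by
        rw [layerConst]
        ring
    _ ≤ _ := h2
    _ = x * z := by
        rw [h]
        ring

end PFPNE

end

theorem mainTheorem1 (k : ℕ) (ν ρ C c : ℝ) (hν : 0 < ν) (hρ : 0 < ρ) (hρ1 : ρ < 1)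
    (hC : 1 ≤ C) (hc : 2 ≤ c) :
    ∃ (K : ℝ) (p : ℕ), ∀ (X : Type*) (P : HierarchicalPartition X k) (M T : ℕ)
      (f : Fin M → X → ℝ) (Δ c₁ : ℝ)
      (Ω : Type*) [MeasurableSpace Ω] (μ : Measure Ω) [IsProbabilityMeasure μ]
      (Y : Fin M → ℕ → ℕ → ℕ → Ω → ℝ) (dbar dmax : ℝ),
      1 ≤ M → 1 ≤ T →
      (∀ m x, f m x ∈ Set.Icc (0 : ℝ) 1) →
      (∀ m, XArmed.WeakLipschitz P ν ρ (f m)) →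
      XArmed.WeakLipschitz P ν ρ (XArmed.avgObjective f) →
      (∀ m, |XArmed.optValue (f m) - XArmed.optValue (XArmed.avgObjective f)| ≤ Δ) →
      (2 * (M : ℝ) ^ 2) ^ (1 / 8 : ℝ) ≤ c₁ →
      XArmed.IsRewardTable P f μ Y →
      dbar = XArmed.nearOptDim P ν ρ C 6 (XArmed.avgObjective f) →
      dmax = ⨆ m, XArmed.nearOptDim P ν ρ C 12 (f m) →
      Integrable (fun ω => PFPNE.regret (a := ⟨k, M, T, ν, ρ, c, c₁, 1 / M, Δ⟩) P f
        (fun m h i n => Y m h i n ω)) μ ∧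
      ∫ ω, PFPNE.regret (a := ⟨k, M, T, ν, ρ, c, c₁, 1 / M, Δ⟩) P f
        (fun m h i n => Y m h i n ω) ∂μ ≤
        K * (1 + Real.log c₁) * (1 + Real.log (M * T)) ^ p *
          ((M : ℝ) ^ ((dbar + 1) / (dbar + 2)) * (T : ℝ) ^ ((dbar + 1) / (dbar + 2)) +
            M * (T : ℝ) ^ ((dmax + 1) / (dmax + 2))) := by
  set B₀ : ℝ := 3 * k * C * ((c ^ 2 / ν ^ 2 + 1) / ρ ^ 2) with hB₀
  have h1ρ : 0 < 1 - ρ := by linarith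
  have hB₀' : 0 ≤ B₀ := by positivity
  -- The coefficient of the good-event bound with the logarithm factored out, plus 4 for the failure
  -- event.
  set K : ℝ := ν * (35 * (1 + B₀ / (1 - ρ)) + 11 * (2 + B₀)) + 4 with hK
  have hK0 : 0 ≤ K := by positivity
  refine ⟨K, 1, ?_⟩
  intro X P M T f Δ c₁ Ω _ μ _ Y dbar dmax hM hT hf hw hw' hΔ hc₁ hY _ hdmax
  let a : PFPNE.Params := ⟨k, M, T, ν, ρ, c, c₁, 1 / M, Δ⟩
  have hM1 : (1 : ℝ) ≤ M := by exact_mod_cast hM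
  have hT1 : (1 : ℝ) ≤ T := by exact_mod_cast hT
  have hMT1 : (1 : ℝ) ≤ M * T := one_le_mul_of_one_le_of_one_le hM1 hT1
  -- For k = 0 the root would be an empty union, yet it contains its representative.
  have hk : 0 < k := by
    rcases Nat.eq_zero_or_pos k with rfl | hk
    · have h1 := P.rep_mem 0 0 (by simp)
      rw [P.cell_split 0 0 (by simp)] at h1
      simp at h1
    · exact hk
  have h2 : (2 : ℝ) ^ (1 / 8 : ℝ) ≤ c₁ := by
    refine le_trans (Real.rpow_le_rpow (by norm_num) ?_ (by norm_num)) hc₁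
    nlinarith
  have hc₁1 : 1 ≤ c₁ := le_trans (Real.one_le_rpow (by norm_num) (by norm_num)) h2
  have hc₁pos : 0 < c₁ := by linarith
  -- This lower bound is what makes the width of a single-sample estimate large enough in
  -- `localWidth_slack`.
  have hlogc : Real.log 2 / 8 ≤ Real.log c₁ := by
    have := Real.log_le_log (by positivity) h2
    rw [Real.log_rpow (by norm_num)] at this
    linarith
  have hlogMT : 0 ≤ Real.log (M * T) := Real.log_nonneg hMT1
  have hlogc0 : 0 ≤ Real.log c₁ := Real.log_nonneg hc₁1
  have hL : PFPNE.logTerm a = Real.log c₁ + Real.log (M * T) := by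
    rw [← Real.log_mul (by positivity) (by positivity)]
    change Real.log (c₁ * T / (1 / M)) = _
    congr 1
    field_simp
  have H : a.Valid :=
    { k_pos := hk, M_pos := hM, T_pos := hT, ν_pos := hν, ρ_pos := hρ, ρ_lt_one := hρ1,
      two_le_c := hc, log_two_le := by rw [hL]; linarith }
  have S : PFPNE.Setting (a := a) P f :=
    { valid := H, mem_Icc := hf, lip := hw, lip_avg := hw', abs_sub_le := hΔ }
  have hD : ∀ m, XArmed.nearOptDim P ν ρ C 12 (f m) ≤ dmax := fun m =>
    hdmax ▸ le_ciSup (f := fun m => XArmed.nearOptDim P ν ρ C 12 (f m))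
      (Set.finite_range _).bddAbove m
  have hD0 : 0 ≤ dmax :=
    (XArmed.nearOptDim_nonneg P ν ρ C 12 (f ⟨0, hM⟩)).trans (hD ⟨0, hM⟩)
  have hexp : Real.exp (-(3 * PFPNE.logTerm a)) ≤ ((M * T : ℝ) ^ 3)⁻¹ := by
    rw [Real.exp_neg]
    refine inv_anti₀ (by positivity) ?_
    have e : Real.log ((M * T : ℝ) ^ 3) = 3 * Real.log (M * T) := by
      rw [Real.log_pow]
      norm_num
    rw [← Real.exp_log (by positivity : (0 : ℝ) < (M * T : ℝ) ^ 3), e, hL]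
    exact Real.exp_le_exp.2 (by linarith)
  obtain ⟨hint, hle⟩ := PFPNE.integral_regret_le (a := a) S hY (by linarith : 0 ≤ C) hD0
    (fun h m => XArmed.nearOptCount_le hk hρ hρ1 hC (hD m) h) hexp
  refine ⟨hint, hle.trans ?_⟩
  -- Expanding the product shows that z dominates log c₁ + log (M T), so one logarithmic power is
  -- enough.
  set z : ℝ := (1 + Real.log c₁) * (1 + Real.log (M * T)) with hz
  have hz1 : 1 ≤ z := one_le_mul_of_one_le_of_one_le (by linarith) (by linarith)
  have hLz : PFPNE.logTerm a ≤ z := by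
    rw [hL, hz]
    nlinarith [mul_nonneg hlogc0 hlogMT]
  have hB : PFPNE.layerConst a C ≤ B₀ * z :=
    PFPNE.layerConst_le (by linarith) hLz hz1 rfl
  set L := PFPNE.layerConst a C
  set R : ℝ := (T : ℝ) ^ ((dmax + 1) / (dmax + 2))
  have hR : 1 ≤ R := Real.one_le_rpow hT1 (by positivity)
  have hMR : 1 ≤ M * R := one_le_mul_of_one_le_of_one_le hM1 hR
  have hdiv : L / (1 - ρ) ≤ B₀ / (1 - ρ) * z := by
    rw [div_mul_eq_mul_div]
    exact div_le_div_of_nonneg_right hB h1ρ.le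
  have hcoef : ν * (35 * (1 + L / (1 - ρ)) + 11 * (2 + L)) ≤ (K - 4) * z := by
    have h3 : 35 * (1 + L / (1 - ρ)) + 11 * (2 + L) ≤
        (35 * (1 + B₀ / (1 - ρ)) + 11 * (2 + B₀)) * z := by linarith
    have h4 := mul_le_mul_of_nonneg_left h3 hν.le
    rw [hK]
    linarith
  have h5 := mul_le_mul_of_nonneg_left hcoef (by linarith : 0 ≤ M * R)
  -- Turns the additive 4 into part of the main term.
  have h6 : 1 ≤ M * R * z := one_le_mul_of_one_le_of_one_le hMR hz1
  have h7 : 0 ≤ (M : ℝ) ^ ((dbar + 1) / (dbar + 2)) * (T : ℝ) ^ ((dbar + 1) / (dbar + 2)) := by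
    positivity
  have h8 : 0 ≤ K * z * ((M : ℝ) ^ ((dbar + 1) / (dbar + 2)) *
      (T : ℝ) ^ ((dbar + 1) / (dbar + 2))) := mul_nonneg (mul_nonneg hK0 (by linarith)) h7
  change M * (ν * (35 * (1 + L / (1 - ρ)) + 11 * (2 + L))) * R + 4 ≤ _
  rw [pow_one, mul_assoc K, ← hz]
  linarith
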